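/- Let $\mathbb B^2$ be the open unit disk of $\mathbb R^2$, let $\mathcal T:\mathbb R^2\to\mathbb R^2$ be a symplectic map, i.e. a $C^1$-diffeomorphism whose Jacobian matrix $J_{\mathcal T}$ satisfies $J_{\mathcal T}^{\intercal}\begin{pmatrix}0&1\\-1&0\end{pmatrix}J_{\mathcal T}=\begin{pmatrix}0&1\\-1&0\end{pmatrix}$ everywhere, and put $\Omega=\mathcal T\mathbb B^2$. Let $\kappa\ge 0$ and let $f$ be a continuous linear functional on $H^1(\Omega)$ (for instance $f\in L^2(\Omega)$, acting by $v\mapsto\int_\Omega fv$). Let $u_{\mathcal T}\in H^1(\Omega)$ be a weak solution of the Robin–Poisson problem $-\Delta u_{\mathcal T}=f$ in $\Omega$, $\partial_n u_{\mathcal T}+\kappa u_{\mathcal T}=0$ on $\partial\Omega$, that is, $$\int_\Omega\nabla u_{\mathcal T}\cdot\nabla\varphi+\kappa\int_{\partial\Omega}u_{\mathcal T}\,\varphi=\langle f,\varphi\rangle\qquad\text{for all }\varphi\in H^1(\Omega),$$ where boundary values are understood as traces and $\partial\Omega$ carries arc length. Set $w=u_{\mathcal T}\circ\mathcal T$, $A=J_{\mathcal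 T}^{-1}J_{\mathcal T}^{-\intercal}$, let $n$ be the outward unit normal to $\mathbb S^1=\partial\mathbb B^2$, and define $\tilde f=f\circ\mathcal T$ by $\langle\tilde f,v\rangle=\langle f,v\circ\mathcal T^{-1}\rangle$ for $v\in H^1(\mathbb B^2)$. Then $\tilde f$ is a continuous linear functional on $H^1(\mathbb B^2)$; if $f$ is given by a function, i.e. $\langle f,v\rangle=\int_\Omega fv$ with $fv$ integrable for all $v\in H^1(\Omega)$, then $\tilde f$ is given in the same sense by the composed function $f\circ\mathcal T$. Moreover $w\in H^1(\mathbb B^2)$, and $w$ attains $$\inf_{v\in H^1(\mathbb B^2)}\left\{\frac12\int_{\mathbb B^2}A\nabla v\cdot\nabla v+\frac\kappa2\int_{\mathbb S^1}|J_{\mathcal T}^{-\intercal}n|\,v^2-\langle\tilde f,v\rangle\right\};$$ equivalently, $w$ satisfies the variational equation $$\int_{\mathbb B^2}A\nabla w\cdot\nabla\varphi+\kappa\int_{\mathbb S^1}|J_{\mathcal T}^{-\intercal}n|\,w\,\varphi=\langle\tilde f,\varphi\rangle\qquad\text{for all }\varphi\in H^1(\mathbb B^2).$$ If $\kappa>0$,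 then $w$ is the only minimizer, up to equality almost everywhere in $\mathbb B^2$. -/

import Mathlib

open MeasureTheory Filter Topology Set
open scoped ContDiff Matrix

noncomputable section

namespace RobinSymp

/-- The Euclidean plane. -/
abbrev Plane : Type := EuclideanSpace ℝ (Fin 2)

/-- The open unit disk. -/
abbrev disk : Set Plane := Metric.ball 0 1

/-! ### Sobolev space `H¹` -/

/-- `g` is the weak gradient of `u` in the open set `Ω`. -/
def IsWeakGrad (Ω : Set Plane) (u : Plane → ℝ) (g : Plane → Plane) : Prop :=
  LocallyIntegrableOn u Ω ∧ LocallyIntegrableOn g Ω ∧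
  ∀ φ : Plane → ℝ, ContDiff ℝ ∞ φ → HasCompactSupport φ → tsupport φ ⊆ Ω →
    ∀ e : Plane, ∫ x in Ω, u x * fderiv ℝ φ x e = - ∫ x in Ω, inner ℝ (g x) e * φ x

/-- `u ∈ H¹(Ω)`; only the values of `u` on `Ω`, up to null sets, matter. -/
def MemH1 (Ω : Set Plane) (u : Plane → ℝ) : Prop :=
  MemLp u 2 (volume.restrict Ω) ∧
  ∃ g : Plane → Plane, MemLp g 2 (volume.restrict Ω) ∧ IsWeakGrad Ω u g

open Classical in
/-- The weak gradient `∇u` in `Ω`, which is unique up to null sets (and `0` if there is none). -/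
def weakGrad (Ω : Set Plane) (u : Plane → ℝ) : Plane → Plane :=
  if h : ∃ g, IsWeakGrad Ω u g then h.choose else 0

/-- The norm of `H¹(Ω)`. -/
def h1Norm (Ω : Set Plane) (u : Plane → ℝ) : ℝ :=
  Real.sqrt ((∫ x in Ω, u x ^ 2) + ∫ x in Ω, ‖weakGrad Ω u x‖ ^ 2)

/-! ### Boundary measure and trace -/

/-- Arc length (one-dimensional Hausdorff measure) on the boundary of `Ω`. -/
def bdry (Ω : Set Plane) : Measure Plane := (μH[1] : Measure Plane).restrict (frontier Ω)

/-- `g ∈ L²(∂Ω)` is the trace of `u` on `∂Ω`: some sequence of functions that are `C¹` on the whole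
plane converges to `u` in `H¹(Ω)`, and its restrictions to `∂Ω` converge to `g` in `L²(∂Ω)`. -/
def IsTrace (Ω : Set Plane) (u : Plane → ℝ) (g : Plane → ℝ) : Prop :=
  MemLp g 2 (bdry Ω) ∧
  ∃ φ : ℕ → Plane → ℝ, (∀ k, ContDiff ℝ 1 (φ k)) ∧
    Tendsto (fun k => eLpNorm (fun x => φ k x - u x) 2 (volume.restrict Ω)) atTop (𝓝 0) ∧
    Tendsto (fun k => eLpNorm (fun x => gradient (φ k) x - weakGrad Ω u x) 2
      (volume.restrict Ω)) atTop (𝓝 0) ∧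
    Tendsto (fun k => eLpNorm (fun x => φ k x - g x) 2 (bdry Ω)) atTop (𝓝 0)

open Classical in
/-- The trace of `u` on `∂Ω`. If `Ω` is a bounded `C¹` domain and `u ∈ H¹(Ω)`, it exists and is
unique up to null sets. -/
def trace (Ω : Set Plane) (u : Plane → ℝ) : Plane → ℝ :=
  if h : ∃ g, IsTrace Ω u g then h.choose else 0

/-! ### Source terms -/

/-- `F` is a continuous linear functional on `H¹(Ω)`. -/
structure IsH1Dual (Ω : Set Plane) (F : (Plane → ℝ) → ℝ) : Prop where
  map_add : ∀ u v, MemH1 Ω u → MemH1 Ω v → F (fun x => u x + v x) = F u + F v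
  map_smul : ∀ (c : ℝ) (u), MemH1 Ω u → F (fun x => c * u x) = c * F u
  bound : ∃ C : ℝ, ∀ u, MemH1 Ω u → |F u| ≤ C * h1Norm Ω u

/-- The functional `F` on `H¹(Ω)` is given by the function `f`, i.e. `⟨F, v⟩ = ∫_Ω f v`. -/
def IsGivenBy (Ω : Set Plane) (F : (Plane → ℝ) → ℝ) (f : Plane → ℝ) : Prop :=
  ∀ v, MemH1 Ω v → IntegrableOn (fun x => f x * v x) Ω ∧ F v = ∫ x in Ω, f x * v x

/-- The source term `f ∘ T` for a functional `f`, where `T` preserves volume: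
`⟨f ∘ T, v⟩ = ⟨f, v ∘ T⁻¹⟩`. -/
def sourceComp (F : (Plane → ℝ) → ℝ) (T : Plane ≃ Plane) : (Plane → ℝ) → ℝ :=
  fun v => F (v ∘ T.symm)

/-! ### Symplectic maps -/

/-- The Jacobian matrix `(∂ⱼ Tᵢ)`. -/
def jac (T : Plane → Plane) (x : Plane) : Matrix (Fin 2) (Fin 2) ℝ :=
  Matrix.of fun i j => (fderiv ℝ T x (EuclideanSpace.single j 1)) i

/-- A symplectic map of the plane: a `C¹`-diffeomorphism whose Jacobian matrix preserves the
standard symplectic form. -/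
structure IsSymplecticMap (T : Plane ≃ Plane) : Prop where
  contDiff : ContDiff ℝ 1 T
  contDiff_symm : ContDiff ℝ 1 T.symm
  symplectic : ∀ x, (jac T x)ᵀ * !![0, 1; -1, 0] * jac T x = !![0, 1; -1, 0]

/-- `A = J_T⁻¹ J_T⁻ᵀ`. -/
def metricTensor (T : Plane → Plane) (x : Plane) : Matrix (Fin 2) (Fin 2) ℝ :=
  (jac T x)⁻¹ * ((jac T x)⁻¹)ᵀ

/-- `|J_T⁻ᵀ n|` at a point `x` of the unit circle, where the outward unit normal is `n = x`. -/
def tangentialJacobian (T : Plane → Plane) (x : Plane) : ℝ :=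
  ‖Matrix.toEuclideanLin ((jac T x)⁻¹)ᵀ x‖

/-! ### The two Robin problems -/

/-- `u ∈ H¹(Ω)` solves `-Δu = F` in `Ω`, `∂ₙu + κ u = 0` on `∂Ω`, in the weak sense. -/
def IsRobinPoissonSolution (Ω : Set Plane) (κ : ℝ) (F : (Plane → ℝ) → ℝ) (u : Plane → ℝ) : Prop :=
  MemH1 Ω u ∧ ∀ φ, MemH1 Ω φ →
    (∫ x in Ω, inner ℝ (weakGrad Ω u x) (weakGrad Ω φ x))
      + κ * (∫ x, trace Ω u x * trace Ω φ x ∂(bdry Ω)) = F φ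

/-- The bilinear form `∫ A∇v·∇φ + κ ∫_{S¹} |J_T⁻ᵀ n| v φ` on `H¹` of the disk. -/
def diskForm (T : Plane → Plane) (κ : ℝ) (v φ : Plane → ℝ) : ℝ :=
  (∫ x in disk, inner ℝ (Matrix.toEuclideanLin (metricTensor T x) (weakGrad disk v x))
      (weakGrad disk φ x))
    + κ * ∫ x, tangentialJacobian T x * (trace disk v x * trace disk φ x) ∂(bdry disk)

/-- The energy `½ ∫ A∇v·∇v + (κ/2) ∫_{S¹} |J_T⁻ᵀ n| v² - ⟨G, v⟩` on `H¹` of the disk. -/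
def diskEnergy (T : Plane → Plane) (κ : ℝ) (G : (Plane → ℝ) → ℝ) (v : Plane → ℝ) : ℝ :=
  (1 / 2) * (∫ x in disk,
      inner ℝ (Matrix.toEuclideanLin (metricTensor T x) (weakGrad disk v x)) (weakGrad disk v x))
    + (κ / 2) * (∫ x, tangentialJacobian T x * trace disk v x ^ 2 ∂(bdry disk))
    - G v

/-- `v` attains the infimum of the energy over `H¹` of the disk. -/
def IsDiskMinimizer (T : Plane → Plane) (κ : ℝ) (G : (Plane → ℝ) → ℝ) (v : Plane → ℝ) : Prop :=
  MemH1 disk v ∧ ∀ v', MemH1 disk v' → diskEnergy T κ G v ≤ diskEnergy T κ G v'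

end RobinSymp

end

open RobinSymp

namespace RobinSymp

section WeakGradient

/-! ### Weak gradients -/

/-! In the plane the symplectic condition says `det J = 1`, so `T` preserves area
(`IsSymplecticMap.isVolumeDiffeo`), and composition with `T` identifies `H¹(Ω)` with `H¹` of the
disk. Gradients transform by `∇(v ∘ T) = Jᵀ (∇v) ∘ T`, and `A = (JᵀJ)⁻¹` cancels the two factors
`Jᵀ`. On the boundary, arc length of `∂Ω` pulls back to the circle with density `|Jτ|`, where `τ` is
the unit tangent, and `det J = 1` gives `|Jτ| = |J⁻ᵀn|`. Hence the disk form at `u ∘ T`, `v ∘ T`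
equals the Robin form at `u`, `v` (`IsSymplecticMap.diskForm_comp`).

The variational equation for `w = u ∘ T` is then the weak equation for `u` tested with `φ ∘ T⁻¹`. If
`z = v ∘ T⁻¹ - u`, expanding the quadratic energy around `w` leaves exactly half the Robin form of
`z`, because the linear term is the weak equation tested with `z`. This form is nonnegative, so `w`
is a minimizer. If `κ > 0` and the form vanishes at `z`, then `z ∘ T` has zero gradient and zero
trace on the disk, and a Poincaré inequality gives `z ∘ T = 0`.

The analytic work is to justify these rules for weak gradients and traces, which are defined by
choice and so are usable only once uniqueness is known. The weak chain rule
(`IsVolumeDiffeo.isWeakGrad_comp`) goes through mollification, since `T` is only `C¹`. The boundary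
density comes from an area formula for injective `C¹` curves
(`hausdorffMeasure_image_eq_lintegral`). On the disk, one divergence identity
(`integral_bdry_disk_sq`) yields both the trace inequality, hence existence and uniqueness of
traces, and the Poincaré inequality. Traces on `Ω` are obtained by transport from the disk. -/

lemma integrable_smul_of_locallyIntegrableOn {E : Type*} [NormedAddCommGroup E] [NormedSpace ℝ E]
    {Ω : Set Plane} {f : Plane → E} (hf : LocallyIntegrableOn f Ω)
    {φ : Plane → ℝ} (hφ : Continuous φ) (hc : HasCompactSupport φ) (hs : tsupport φ ⊆ Ω) :
    Integrable (fun x => φ x • f x) := by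
  have h1 : IntegrableOn f (tsupport φ) := hf.integrableOn_compact_subset hs hc
  have h2 : IntegrableOn (fun x => φ x • f x) (tsupport φ) :=
    h1.continuousOn_smul hφ.continuousOn hc
  rw [← integrableOn_iff_integrable_of_support_subset (s := tsupport φ)]
  · exact h2
  · intro x hx
    apply subset_tsupport
    intro h0
    simp [h0] at hx

lemma tsupport_fderiv_apply_subset (φ : Plane → ℝ) (e : Plane) :
    tsupport (fun x => fderiv ℝ φ x e) ⊆ tsupport φ := by
  refine (closure_mono ?_).trans (tsupport_fderiv_subset ℝ (f := φ))
  intro x hx h0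
  simp [h0] at hx

lemma continuous_fderiv_apply_const {φ : Plane → ℝ} (hφ : ContDiff ℝ 1 φ) (e : Plane) :
    Continuous (fun x => fderiv ℝ φ x e) :=
  (hφ.continuous_fderiv one_ne_zero).clm_apply continuous_const

lemma hasCompactSupport_fderiv_apply {φ : Plane → ℝ} (hc : HasCompactSupport φ) (e : Plane) :
    HasCompactSupport (fun x => fderiv ℝ φ x e) :=
  hc.of_isClosed_subset (isClosed_tsupport _) (tsupport_fderiv_apply_subset φ e)

lemma IsWeakGrad.integrable_left {Ω : Set Plane} {u : Plane → ℝ} {g : Plane → Plane}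
    (h : IsWeakGrad Ω u g) {φ : Plane → ℝ} (hφ : ContDiff ℝ ∞ φ) (hc : HasCompactSupport φ)
    (hs : tsupport φ ⊆ Ω) (e : Plane) :
    Integrable (fun x => u x * fderiv ℝ φ x e) (volume.restrict Ω) := by
  have := integrable_smul_of_locallyIntegrableOn h.1
    (continuous_fderiv_apply_const (hφ.of_le (by simp)) e)
    (hasCompactSupport_fderiv_apply hc e) ((tsupport_fderiv_apply_subset φ e).trans hs)
  refine (this.congr (Eventually.of_forall fun x => ?_)).restrict
  simp [mul_comm]

lemma IsWeakGrad.integrable_smul {Ω : Set Plane} {u : Plane → ℝ} {g : Plane → Plane}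
    (h : IsWeakGrad Ω u g) {φ : Plane → ℝ} (hφ : ContDiff ℝ ∞ φ) (hc : HasCompactSupport φ)
    (hs : tsupport φ ⊆ Ω) : Integrable (fun x => φ x • g x) :=
  integrable_smul_of_locallyIntegrableOn h.2.1 hφ.continuous hc hs

lemma IsWeakGrad.integrable_right {Ω : Set Plane} {u : Plane → ℝ} {g : Plane → Plane}
    (h : IsWeakGrad Ω u g) {φ : Plane → ℝ} (hφ : ContDiff ℝ ∞ φ) (hc : HasCompactSupport φ)
    (hs : tsupport φ ⊆ Ω) (e : Plane) :
    Integrable (fun x => inner ℝ (g x) e * φ x) (volume.restrict Ω) := by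
  have h1 := ((h.integrable_smul hφ hc hs).inner_const (𝕜 := ℝ) e).restrict (s := Ω)
  refine h1.congr (Eventually.of_forall fun x => ?_)
  simp [real_inner_smul_left, mul_comm]

lemma IsWeakGrad.add {Ω : Set Plane} {u v : Plane → ℝ} {g h : Plane → Plane}
    (hu : IsWeakGrad Ω u g) (hv : IsWeakGrad Ω v h) :
    IsWeakGrad Ω (fun x => u x + v x) (fun x => g x + h x) := by
  refine ⟨hu.1.add hv.1, hu.2.1.add hv.2.1, fun φ hφ hc hs e => ?_⟩
  simp only [add_mul, inner_add_left]
  rw [integral_add (hu.integrable_left hφ hc hs e) (hv.integrable_left hφ hc hs e),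
    integral_add (hu.integrable_right hφ hc hs e) (hv.integrable_right hφ hc hs e),
    hu.2.2 φ hφ hc hs e, hv.2.2 φ hφ hc hs e]
  ring

lemma IsWeakGrad.const_mul {Ω : Set Plane} {u : Plane → ℝ} {g : Plane → Plane}
    (hu : IsWeakGrad Ω u g) (c : ℝ) :
    IsWeakGrad Ω (fun x => c * u x) (fun x => c • g x) := by
  refine ⟨hu.1.smul c, hu.2.1.smul c, fun φ hφ hc hs e => ?_⟩
  simp only [mul_assoc, real_inner_smul_left]
  rw [integral_const_mul, integral_const_mul, hu.2.2 φ hφ hc hs e]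
  ring

/-- The fundamental lemma of the calculus of variations applies to `g - h`, whose integral against a
test function is computed one direction `e` at a time. This makes the chosen representative
`weakGrad` computable. -/
lemma IsWeakGrad.ae_eq {Ω : Set Plane} (hΩ : IsOpen Ω) {u : Plane → ℝ} {g h : Plane → Plane}
    (hg : IsWeakGrad Ω u g) (hh : IsWeakGrad Ω u h) : g =ᵐ[volume.restrict Ω] h := by
  have key : ∀ᵐ x ∂(volume : Measure Plane), x ∈ Ω → g x - h x = 0 := by
    refine hΩ.ae_eq_zero_of_integral_contDiff_smul_eq_zero (f := fun x => g x - h x)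
      (hg.2.1.sub hh.2.1) fun φ hφ hc hs => ?_
    have hi := (hg.integrable_smul hφ hc hs).sub (hh.integrable_smul hφ hc hs)
    refine ext_inner_right ℝ fun e => ?_
    have hi' : Integrable (fun x => φ x • (g x - h x)) := by
      refine hi.congr (Eventually.of_forall fun x => ?_)
      simp [smul_sub]
    rw [inner_zero_left, real_inner_comm, ← integral_inner hi']
    have h0 : ∫ x, inner ℝ e (φ x • (g x - h x))
        = ∫ x in Ω, inner ℝ e (φ x • (g x - h x)) := by
      refine (setIntegral_eq_integral_of_forall_compl_eq_zero fun x hx => ?_).symm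
      rw [image_eq_zero_of_notMem_tsupport (fun h' => hx (hs h'))]
      simp
    have h1 : ∀ x, inner ℝ e (φ x • (g x - h x))
        = inner ℝ (g x) e * φ x - inner ℝ (h x) e * φ x := by
      intro x
      rw [real_inner_smul_right, inner_sub_right, real_inner_comm, real_inner_comm e (h x)]
      ring
    rw [h0]
    simp only [h1]
    rw [integral_sub (hg.integrable_right hφ hc hs e) (hh.integrable_right hφ hc hs e)]
    have := hg.2.2 φ hφ hc hs e
    have := hh.2.2 φ hφ hc hs e
    linarith
  rw [EventuallyEq, ae_restrict_iff' hΩ.measurableSet]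
  filter_upwards [key] with x hx hxΩ using sub_eq_zero.1 (hx hxΩ)

lemma MemH1.isWeakGrad {Ω : Set Plane} {u : Plane → ℝ} (hu : MemH1 Ω u) :
    IsWeakGrad Ω u (weakGrad Ω u) := by
  obtain ⟨-, g, -, hg⟩ := hu
  have h : ∃ g, IsWeakGrad Ω u g := ⟨g, hg⟩
  rw [weakGrad, dif_pos h]
  exact h.choose_spec

lemma IsWeakGrad.ae_eq_weakGrad {Ω : Set Plane} (hΩ : IsOpen Ω) {u : Plane → ℝ}
    {g : Plane → Plane} (hg : IsWeakGrad Ω u g) : weakGrad Ω u =ᵐ[volume.restrict Ω] g := by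
  have h : ∃ g, IsWeakGrad Ω u g := ⟨g, hg⟩
  rw [weakGrad, dif_pos h]
  exact h.choose_spec.ae_eq hΩ hg

lemma MemH1.memLp_weakGrad {Ω : Set Plane} (hΩ : IsOpen Ω) {u : Plane → ℝ} (hu : MemH1 Ω u) :
    MemLp (weakGrad Ω u) 2 (volume.restrict Ω) := by
  obtain ⟨-, g, hg2, hg⟩ := hu
  exact (memLp_congr_ae (hg.ae_eq_weakGrad hΩ)).2 hg2

lemma MemH1.add {Ω : Set Plane} {u v : Plane → ℝ} (hu : MemH1 Ω u) (hv : MemH1 Ω v) :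
    MemH1 Ω (fun x => u x + v x) := by
  obtain ⟨hu2, g, hg2, hg⟩ := hu
  obtain ⟨hv2, h, hh2, hh⟩ := hv
  exact ⟨hu2.add hv2, _, hg2.add hh2, hg.add hh⟩

lemma MemH1.const_mul {Ω : Set Plane} {u : Plane → ℝ} (hu : MemH1 Ω u) (c : ℝ) :
    MemH1 Ω (fun x => c * u x) := by
  obtain ⟨hu2, g, hg2, hg⟩ := hu
  exact ⟨hu2.const_mul c, _, hg2.const_smul c, hg.const_mul c⟩

lemma MemH1.weakGrad_add {Ω : Set Plane} (hΩ : IsOpen Ω) {u v : Plane → ℝ} (hu : MemH1 Ω u)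
    (hv : MemH1 Ω v) : weakGrad Ω (fun x => u x + v x) =ᵐ[volume.restrict Ω]
      fun x => weakGrad Ω u x + weakGrad Ω v x :=
  (hu.isWeakGrad.add hv.isWeakGrad).ae_eq_weakGrad hΩ

end WeakGradient

section Mollification

open scoped Convolution ENNReal

/-! ### Mollification in `L²` -/

variable {E : Type*} [NormedAddCommGroup E] [NormedSpace ℝ E]

/-- The mollification of `h` by the normalized bump function `b`. -/
noncomputable def mollify (b : ContDiffBump (0 : Plane)) (h : Plane → E) : Plane → E :=
  (b.normed volume ⋆[ContinuousLinearMap.lsmul ℝ ℝ, volume] h)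

lemma mollify_apply (b : ContDiffBump (0 : Plane)) (h : Plane → E) (x : Plane) :
    mollify b h x = ∫ y, b.normed volume y • h (x - y) := rfl

lemma eLpNorm_two_sq {α F : Type*} [MeasurableSpace α] [TopologicalSpace F] [ContinuousENorm F]
    (f : α → F) (μ : Measure α) : eLpNorm f 2 μ ^ 2 = ∫⁻ x, ‖f x‖ₑ ^ 2 ∂μ := by
  have := eLpNorm_nnreal_pow_eq_lintegral (f := f) (μ := μ) (p := 2) two_ne_zero
  simpa using this

lemma lintegral_sq_le_of_isProbabilityMeasure {α : Type*} [MeasurableSpace α] (ν : Measure α)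
    [IsProbabilityMeasure ν] {f : α → ℝ≥0∞} (hf : AEMeasurable f ν) :
    (∫⁻ x, f x ∂ν) ^ 2 ≤ ∫⁻ x, f x ^ 2 ∂ν := by
  have h1 : eLpNorm f 1 ν ≤ eLpNorm f 2 ν :=
    eLpNorm_le_eLpNorm_of_exponent_le (by norm_num) hf.aestronglyMeasurable
  have h2 := eLpNorm_two_sq f ν
  rw [eLpNorm_one_eq_lintegral_enorm] at h1
  simp only [enorm_eq_self] at h1 h2
  rw [← h2]
  gcongr

lemma lintegral_ofReal_normed (b : ContDiffBump (0 : Plane)) :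
    ∫⁻ y, ENNReal.ofReal (b.normed volume y) = 1 := by
  rw [← ofReal_integral_eq_lintegral_ofReal b.integrable_normed
    (Eventually.of_forall b.nonneg_normed), b.integral_normed, ENNReal.ofReal_one]

lemma measurable_ofReal_normed (b : ContDiffBump (0 : Plane)) :
    Measurable fun y => ENNReal.ofReal (b.normed volume y) :=
  b.continuous_normed.measurable.ennreal_ofReal

/-- The normalized bump is the density of a probability measure, so the square of the mean is at
most the mean of the square. -/
lemma enorm_mollify_sq_le (b : ContDiffBump (0 : Plane)) {h : Plane → E}
    (hh : AEStronglyMeasurable h) (x : Plane) :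
    ‖mollify b h x‖ₑ ^ 2 ≤ ∫⁻ y, ENNReal.ofReal (b.normed volume y) * ‖h (x - y)‖ₑ ^ 2 := by
  set ν := (volume : Measure Plane).withDensity fun y => ENNReal.ofReal (b.normed volume y)
  have hν : IsProbabilityMeasure ν := ⟨by
    simp [ν, withDensity_apply, lintegral_ofReal_normed]⟩
  have hm : AEMeasurable (fun y => ‖h (x - y)‖ₑ) volume :=
    (hh.comp_quasiMeasurePreserving (quasiMeasurePreserving_sub_left volume x)).enorm
  have hm' : AEMeasurable (fun y => ‖h (x - y)‖ₑ) ν :=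
    hm.mono_ac (withDensity_absolutelyContinuous _ _)
  have h1 : ‖mollify b h x‖ₑ ≤ ∫⁻ y, ‖h (x - y)‖ₑ ∂ν := by
    rw [mollify_apply]
    refine (enorm_integral_le_lintegral_enorm _).trans_eq ?_
    rw [lintegral_withDensity_eq_lintegral_mul₀ (measurable_ofReal_normed b).aemeasurable hm]
    refine lintegral_congr fun y => ?_
    rw [enorm_smul, Real.enorm_of_nonneg (b.nonneg_normed y)]
    rfl
  calc ‖mollify b h x‖ₑ ^ 2 ≤ (∫⁻ y, ‖h (x - y)‖ₑ ∂ν) ^ 2 := by gcongr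
    _ ≤ ∫⁻ y, ‖h (x - y)‖ₑ ^ 2 ∂ν := lintegral_sq_le_of_isProbabilityMeasure ν hm'
    _ = _ := by
      rw [lintegral_withDensity_eq_lintegral_mul₀ (measurable_ofReal_normed b).aemeasurable
        (hm.pow_const 2)]
      rfl

/-- Integrate the pointwise bound, exchange the integrals by Tonelli and use translation invariance;
the bump has total mass one. -/
lemma eLpNorm_mollify_le (b : ContDiffBump (0 : Plane)) {h : Plane → E}
    (hh : AEStronglyMeasurable h) : eLpNorm (mollify b h) 2 volume ≤ eLpNorm h 2 volume := by
  have key : eLpNorm (mollify b h) 2 volume ^ 2 ≤ eLpNorm h 2 volume ^ 2 := by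
    rw [eLpNorm_two_sq, eLpNorm_two_sq]
    calc ∫⁻ x, ‖mollify b h x‖ₑ ^ 2
        ≤ ∫⁻ x, ∫⁻ y, ENNReal.ofReal (b.normed volume y) * ‖h (x - y)‖ₑ ^ 2 :=
          lintegral_mono fun x => enorm_mollify_sq_le b hh x
      _ = ∫⁻ y, ∫⁻ x, ENNReal.ofReal (b.normed volume y) * ‖h (x - y)‖ₑ ^ 2 := by
          refine lintegral_lintegral_swap ?_
          refine AEMeasurable.mul (M := ℝ≥0∞) (f := fun p : Plane × Plane =>
            ENNReal.ofReal (b.normed volume p.2)) (g := fun p => ‖h (p.1 - p.2)‖ₑ ^ 2) ?_ ?_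
          · exact ((measurable_ofReal_normed b).comp measurable_snd).aemeasurable
          · exact (hh.comp_quasiMeasurePreserving
              (quasiMeasurePreserving_sub_of_right_invariant volume volume)).enorm.pow_const 2
      _ = ∫⁻ y, ENNReal.ofReal (b.normed volume y) * ∫⁻ x, ‖h x‖ₑ ^ 2 := by
          refine lintegral_congr fun y => ?_
          rw [lintegral_const_mul' _ _ ENNReal.ofReal_ne_top,
            lintegral_sub_right_eq_self (fun x => ‖h x‖ₑ ^ 2) y]
      _ = ∫⁻ x, ‖h x‖ₑ ^ 2 := by
          rw [lintegral_mul_const _ (measurable_ofReal_normed b), lintegral_ofReal_normed, one_mul]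
  exact (ENNReal.pow_le_pow_left_iff two_ne_zero).1 key

lemma convolutionExists_normed (b : ContDiffBump (0 : Plane)) {h : Plane → E}
    (hh : LocallyIntegrable h) :
    ConvolutionExists (b.normed volume) h (ContinuousLinearMap.lsmul ℝ ℝ) volume :=
  b.hasCompactSupport_normed.convolutionExists_left _ b.continuous_normed hh

lemma contDiff_mollify (b : ContDiffBump (0 : Plane)) {h : Plane → E}
    (hh : LocallyIntegrable h) {n : ℕ∞} : ContDiff ℝ n (mollify b h) :=
  b.hasCompactSupport_normed.contDiff_convolution_left _ b.contDiff_normed hh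

lemma mollify_add (b : ContDiffBump (0 : Plane)) {g h : Plane → E}
    (hg : LocallyIntegrable g) (hh : LocallyIntegrable h) (x : Plane) :
    mollify b (g + h) x = mollify b g x + mollify b h x := by
  have := ConvolutionExists.distrib_add (convolutionExists_normed b hg)
    (convolutionExists_normed b hh)
  exact congrFun this x

/-- Dilation by `r` scales planar area by `r⁻² ≤ 4`, whence the factor `2` for the norm. -/
lemma eLpNorm_comp_smul_le {F : Type*} [NormedAddCommGroup F] {r : ℝ} (hr : 1 / 2 ≤ r)
    (h : Plane → F) : eLpNorm (fun x => h (r • x)) 2 volume ≤ 2 * eLpNorm h 2 volume := by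
  have hr0 : r ≠ 0 := by linarith
  have h1 : eLpNorm (fun x => h (r • x)) 2 volume ^ 2 ≤ (2 * eLpNorm h 2 volume) ^ 2 := by
    rw [mul_pow, eLpNorm_two_sq, eLpNorm_two_sq]
    have h2 := lintegral_map_equiv (μ := (volume : Measure Plane)) (fun x => ‖h x‖ₑ ^ 2)
      (Homeomorph.smulOfNeZero r hr0).toMeasurableEquiv
    have h3 : Measure.map (Homeomorph.smulOfNeZero r hr0).toMeasurableEquiv
        (volume : Measure Plane) = _ := Measure.map_addHaar_smul volume hr0
    rw [h3, lintegral_smul_measure] at h2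
    refine (h2.symm.trans_le ?_)
    rw [smul_eq_mul]
    gcongr
    rw [show (2 : ℝ≥0∞) ^ 2 = ENNReal.ofReal 4 by norm_num]
    refine ENNReal.ofReal_le_ofReal ?_
    rw [finrank_euclideanSpace_fin, abs_of_nonneg (by positivity)]
    refine inv_le_of_inv_le₀ (by norm_num) ?_
    rw [Units.val_mk0]
    nlinarith
  exact (ENNReal.pow_le_pow_left_iff two_ne_zero).1 h1

/-- Approximate `h` in `L²` by a continuous compactly supported `c`. The error `h - c` costs `2 ·
ε/4` after mollification and dilation and another `ε/4` without them. Uniform continuity of `c`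
controls the remaining term uniformly, which is an `L²` bound only on a set of finite measure, hence
the ball. The dilations `r k` are needed for approximation up to the boundary of the disk; elsewhere
`r k = 1`. -/
lemma tendsto_eLpNorm_mollify_comp_smul [CompleteSpace E] {b : ℕ → ContDiffBump (0 : Plane)} {r : ℕ → ℝ}
    (hb : Tendsto (fun k => (b k).rOut) atTop (𝓝 0)) (hr : Tendsto r atTop (𝓝 1))
    {h : Plane → E} (hh : MemLp h 2 volume) (R : ℝ) :
    Tendsto (fun k => eLpNorm (fun x => mollify (b k) h (r k • x) - h x) 2
      (volume.restrict (Metric.ball 0 R))) atTop (𝓝 0) := by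
  rw [ENNReal.tendsto_nhds_zero]
  intro ε hε
  have hε4 : ε / 4 ≠ 0 := by simp [hε.ne']
  obtain ⟨c, hcs, hcε, hcc, hc2⟩ :=
    hh.exists_hasCompactSupport_eLpNorm_sub_le (by norm_num) hε4
  have hcu := hcs.uniformContinuous_of_continuous hcc
  set B := Metric.ball (0 : Plane) R
  have hB : volume B ≠ ⊤ := measure_ball_lt_top.ne
  obtain ⟨η, hη, hηε⟩ : ∃ η : ℝ, 0 < η ∧
      (volume.restrict B) univ ^ (ENNReal.toReal 2)⁻¹ * ENNReal.ofReal η ≤ ε / 4 := by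
    have hV : (volume.restrict B) univ ^ (ENNReal.toReal 2)⁻¹ ≠ ⊤ := by
      refine ENNReal.rpow_ne_top_of_nonneg (by simp) ?_
      simpa using hB
    obtain ⟨n, hn, hn'⟩ := ENNReal.exists_nnreal_pos_mul_lt hV hε4
    refine ⟨n, hn, ?_⟩
    rw [mul_comm, ENNReal.ofReal_coe_nnreal]
    exact hn'.le
  obtain ⟨δ, hδ, hδc⟩ := Metric.uniformContinuous_iff.1 hcu (η / 2) (by positivity)
  have e1 : ∀ᶠ k in atTop, (b k).rOut < δ := hb.eventually_lt_const hδ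
  have e2 : ∀ᶠ k in atTop, |r k - 1| * |R| < δ := by
    have : Tendsto (fun k => |r k - 1| * |R|) atTop (𝓝 (|1 - 1| * |R|)) :=
      ((hr.sub_const 1).abs).mul_const _
    refine this.eventually_lt_const (by simpa using hδ)
  have e3 : ∀ᶠ k in atTop, 1 / 2 ≤ r k := (hr.eventually_const_lt (by norm_num)).mono fun _ => le_of_lt
  filter_upwards [e1, e2, e3] with k h1 h2 h3
  have hli : LocallyIntegrable h := hh.locallyIntegrable (by norm_num)
  have hlc : LocallyIntegrable c := hcc.locallyIntegrable
  have hd : MemLp (h - c) 2 volume := hh.sub hc2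
  have split : (fun x => mollify (b k) h (r k • x) - h x) =
      (fun x => mollify (b k) (h - c) (r k • x)) +
      ((fun x => mollify (b k) c (r k • x) - c x) + (fun x => (c - h) x)) := by
    funext x
    have := mollify_add (b k) (hli.sub hlc) hlc (r k • x)
    rw [sub_add_cancel] at this
    simp only [Pi.add_apply, Pi.sub_apply, this]
    abel
  have m1 : AEStronglyMeasurable (fun x => mollify (b k) (h - c) (r k • x)) (volume.restrict B) :=
    (((contDiff_mollify (n := 0) (b k) (hli.sub hlc)).continuous).comp
      (continuous_const_smul _)).aestronglyMeasurable
  have m2 : AEStronglyMeasurable (fun x => mollify (b k) c (r k • x) - c x) (volume.restrict B) :=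
    ((((contDiff_mollify (n := 0) (b k) hlc).continuous).comp
      (continuous_const_smul _)).sub hcc).aestronglyMeasurable
  have m3 : AEStronglyMeasurable (fun x => (c - h) x) (volume.restrict B) :=
    ((hc2.sub hh).1).restrict
  have b1 : eLpNorm (fun x => mollify (b k) (h - c) (r k • x)) 2 (volume.restrict B)
      ≤ 2 * (ε / 4) := by
    calc _ ≤ eLpNorm (fun x => mollify (b k) (h - c) (r k • x)) 2 volume :=
          eLpNorm_mono_measure _ Measure.restrict_le_self
      _ ≤ 2 * eLpNorm (mollify (b k) (h - c)) 2 volume := eLpNorm_comp_smul_le h3 _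
      _ ≤ 2 * eLpNorm (h - c) 2 volume := by gcongr; exact eLpNorm_mollify_le _ hd.1
      _ ≤ _ := by gcongr
  have b2 : eLpNorm (fun x => mollify (b k) c (r k • x) - c x) 2 (volume.restrict B)
      ≤ ε / 4 := by
    refine (eLpNorm_le_of_ae_bound (C := η) ?_).trans hηε
    refine (ae_restrict_mem measurableSet_ball).mono fun x hx => ?_
    have hx1 : dist (mollify (b k) c (r k • x)) (c (r k • x)) ≤ η / 2 := by
      refine (b k).dist_normed_convolution_le hcc.aestronglyMeasurable fun y hy => ?_
      exact (hδc (lt_trans hy h1)).le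
    have hx2 : dist (c (r k • x)) (c x) < η / 2 := by
      refine hδc (lt_of_le_of_lt ?_ h2)
      have : r k • x - x = (r k - 1) • x := by rw [sub_smul, one_smul]
      rw [dist_eq_norm, this, norm_smul, Real.norm_eq_abs]
      gcongr
      have : ‖x‖ < R := by simpa using hx
      exact this.le.trans (le_abs_self R)
    rw [← dist_eq_norm]
    linarith [dist_triangle (mollify (b k) c (r k • x)) (c (r k • x)) (c x)]
  have b3 : eLpNorm (fun x => (c - h) x) 2 (volume.restrict B) ≤ ε / 4 := by
    refine (eLpNorm_mono_measure _ Measure.restrict_le_self).trans ?_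
    have : (fun x => (c - h) x) = -(h - c) := by funext x; simp
    rw [this, eLpNorm_neg]
    exact hcε
  rw [split]
  calc _ ≤ _ := eLpNorm_add_le m1 (m2.add m3) (by norm_num)
    _ ≤ 2 * (ε / 4) + (ε / 4 + ε / 4) :=
      add_le_add b1 ((eLpNorm_add_le m2 m3 (by norm_num)).trans (add_le_add b2 b3))
    _ = ε := by
      rw [← two_mul, ← two_mul, ← mul_assoc]
      norm_num
      rw [ENNReal.mul_div_cancel (by norm_num) (by norm_num)]

/-! ### Derivative of the mollification of a Sobolev function -/

/-- The derivative falls on the kernel `ρ`, and `y ↦ ρ (x - y)` is an admissible test function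
because the ball of radius `rOut` around `x` stays in `Ω`. The sign from differentiating `x - y`
cancels the sign in the definition of the weak gradient. -/
lemma IsWeakGrad.fderiv_mollify_indicator {Ω : Set Plane} (hΩ : MeasurableSet Ω) {u : Plane → ℝ}
    {g : Plane → Plane} (hg : IsWeakGrad Ω u g) (hu : LocallyIntegrable (Ω.indicator u))
    (hg' : LocallyIntegrable (Ω.indicator g))
    (b : ContDiffBump (0 : Plane)) {x : Plane} (hx : Metric.closedBall x b.rOut ⊆ Ω) (e : Plane) :
    fderiv ℝ (mollify b (Ω.indicator u)) x e
      = inner ℝ (mollify b (Ω.indicator g) x) e := by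
  set ρ := b.normed volume with hρ
  have hρ1 : ContDiff ℝ ∞ ρ := b.contDiff_normed
  have hρc : HasCompactSupport ρ := b.hasCompactSupport_normed
  have hfl : mollify b (Ω.indicator u)
      = (Ω.indicator u ⋆[(ContinuousLinearMap.lsmul ℝ ℝ).flip, volume] ρ) :=
    (convolution_flip _).symm
  have hd := hρc.hasFDerivAt_convolution_right (ContinuousLinearMap.lsmul ℝ ℝ).flip hu
    (hρ1.of_le (by simp)) x
  rw [hfl, hd.fderiv, convolution_precompR_apply _ hu (hρc.fderiv ℝ)
    (hρ1.continuous_fderiv (by simp))]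
  set ψ : Plane → ℝ := fun y => ρ (x - y) with hψ
  have hψ1 : ContDiff ℝ ∞ ψ := hρ1.comp (contDiff_const.sub contDiff_id)
  have hψs : tsupport ψ ⊆ Metric.closedBall x b.rOut := by
    refine closure_minimal (fun y hy => ?_) Metric.isClosed_closedBall
    have h1 : x - y ∈ Function.support ρ := hy
    rw [hρ, b.support_normed_eq] at h1
    have : dist (x - y) 0 < b.rOut := h1
    rw [dist_zero_right] at this
    rw [Metric.mem_closedBall, dist_comm, dist_eq_norm]
    exact this.le
  have hψc : HasCompactSupport ψ :=
    (isCompact_closedBall x b.rOut).of_isClosed_subset (isClosed_tsupport _) hψs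
  have hψd : ∀ y, fderiv ℝ ψ y e = - fderiv ℝ ρ (x - y) e := by
    intro y
    have h1 : HasFDerivAt ρ (fderiv ℝ ρ (x - y)) (x - y) :=
      (hρ1.differentiable (by simp) _).hasFDerivAt
    have h2 : HasFDerivAt (fun y : Plane => x - y) (-ContinuousLinearMap.id ℝ Plane) y :=
      (hasFDerivAt_id y).const_sub x
    have h3 : HasFDerivAt ψ _ y := h1.comp y h2
    rw [h3.fderiv]
    simp
  have hw := hg.2.2 ψ hψ1 hψc (hψs.trans hx) e
  have hL : (Ω.indicator u ⋆[(ContinuousLinearMap.lsmul ℝ ℝ).flip, volume]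
      fun a => fderiv ℝ ρ a e) x = - ∫ y in Ω, u y * fderiv ℝ ψ y e := by
    rw [← integral_neg, ← integral_indicator hΩ, convolution_def]
    refine integral_congr_ae (Eventually.of_forall fun y => ?_)
    by_cases hy : y ∈ Ω
    · simp [hy, hψd, mul_comm]
    · simp [hy]
  have hR : inner ℝ (mollify b (Ω.indicator g) x) e = ∫ y in Ω, inner ℝ (g y) e * ψ y := by
    have hi : Integrable fun y => b.normed volume y • Ω.indicator g (x - y) :=
      convolutionExists_normed b hg' x
    rw [mollify_apply, real_inner_comm, ← integral_inner hi, ← integral_indicator hΩ,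
      ← integral_sub_left_eq_self _ _ x]
    refine integral_congr_ae (Eventually.of_forall fun y => ?_)
    by_cases hy : y ∈ Ω
    · simp [hy, real_inner_smul_right, hψ, hρ, real_inner_comm, mul_comm]
    · simp [hy]
  rw [hL, hR, hw, neg_neg]

end Mollification

section Pullback

/-! ### Pullback of Sobolev functions by volume-preserving diffeomorphisms -/

/-- A volume-preserving `C¹`-diffeomorphism of the plane. -/
structure IsVolumeDiffeo (T : Plane ≃ Plane) : Prop where
  contDiff : ContDiff ℝ 1 T
  contDiff_symm : ContDiff ℝ 1 T.symm
  measurePreserving : MeasurePreserving T volume volume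

namespace IsVolumeDiffeo

variable {T : Plane ≃ Plane}

/-- The homeomorphism underlying a volume-preserving diffeomorphism. -/
def toHomeomorph (hT : IsVolumeDiffeo T) : Plane ≃ₜ Plane where
  toEquiv := T
  continuous_toFun := hT.contDiff.continuous
  continuous_invFun := hT.contDiff_symm.continuous

lemma symm (hT : IsVolumeDiffeo T) : IsVolumeDiffeo T.symm where
  contDiff := hT.contDiff_symm
  contDiff_symm := by simpa using hT.contDiff
  measurePreserving := MeasurePreserving.symm hT.toHomeomorph.toMeasurableEquiv hT.measurePreserving

lemma measurableEmbedding (hT : IsVolumeDiffeo T) : MeasurableEmbedding T :=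
  hT.toHomeomorph.measurableEmbedding

lemma restrict_preimage (hT : IsVolumeDiffeo T) (Ω : Set Plane) :
    MeasurePreserving T (volume.restrict (T ⁻¹' Ω)) (volume.restrict Ω) :=
  hT.measurePreserving.restrict_preimage_emb hT.measurableEmbedding Ω

lemma isBounded_preimage (hT : IsVolumeDiffeo T) {Ω : Set Plane} (hΩ : Bornology.IsBounded Ω) :
    Bornology.IsBounded (T ⁻¹' Ω) := by
  have h1 : IsCompact (T.symm '' closure Ω) :=
    hΩ.isCompact_closure.image hT.contDiff_symm.continuous
  refine h1.isBounded.subset ?_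
  rw [Equiv.image_eq_preimage_symm, Equiv.symm_symm]
  exact preimage_mono subset_closure

lemma exists_norm_fderiv_le (hT : IsVolumeDiffeo T) {Ω : Set Plane}
    (hΩ : Bornology.IsBounded Ω) : ∃ M : ℝ, 0 ≤ M ∧ ∀ x ∈ Ω, ‖fderiv ℝ T x‖ ≤ M := by
  obtain ⟨M, hM⟩ := hΩ.isCompact_closure.exists_bound_of_continuousOn
    (hT.contDiff.continuous_fderiv one_ne_zero).continuousOn
  exact ⟨|M|, abs_nonneg M, fun x hx => (hM x (subset_closure hx)).trans (le_abs_self M)⟩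

end IsVolumeDiffeo

/-- The gradient `(DT)† (g ∘ T)` of a function `u ∘ T`, where `g` is the gradient of `u`. -/
noncomputable def pullbackGrad (T : Plane → Plane) (g : Plane → Plane) (x : Plane) : Plane :=
  ContinuousLinearMap.adjoint (fderiv ℝ T x) (g (T x))

lemma norm_pullbackGrad_le {T : Plane → Plane} {g : Plane → Plane} {x : Plane} {M : ℝ}
    (h : ‖fderiv ℝ T x‖ ≤ M) : ‖pullbackGrad T g x‖ ≤ M * ‖g (T x)‖ := by
  refine (ContinuousLinearMap.le_opNorm _ _).trans ?_
  rw [LinearIsometryEquiv.norm_map]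
  gcongr

lemma IsVolumeDiffeo.aestronglyMeasurable_pullbackGrad {T : Plane ≃ Plane} (hT : IsVolumeDiffeo T)
    {Ω : Set Plane} {g : Plane → Plane} (hg : AEStronglyMeasurable g (volume.restrict Ω)) :
    AEStronglyMeasurable (pullbackGrad T g) (volume.restrict (T ⁻¹' Ω)) := by
  have h1 : Continuous fun x => ContinuousLinearMap.adjoint (fderiv ℝ T x) :=
    ContinuousLinearMap.adjoint.continuous.comp (hT.contDiff.continuous_fderiv one_ne_zero)
  have h2 := hg.comp_measurePreserving (hT.restrict_preimage Ω)
  exact (ContinuousLinearMap.id ℝ (Plane →L[ℝ] Plane)).aestronglyMeasurable_comp₂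
    h1.aestronglyMeasurable h2

lemma IsVolumeDiffeo.memLp_pullbackGrad {T : Plane ≃ Plane} (hT : IsVolumeDiffeo T)
    {Ω : Set Plane} (hΩ : MeasurableSet Ω) (hb : Bornology.IsBounded Ω) {g : Plane → Plane}
    (hg : MemLp g 2 (volume.restrict Ω)) :
    MemLp (pullbackGrad T g) 2 (volume.restrict (T ⁻¹' Ω)) := by
  obtain ⟨M, -, hM⟩ := hT.exists_norm_fderiv_le (hT.isBounded_preimage hb)
  have h2 : MemLp (fun x => g (T x)) 2 (volume.restrict (T ⁻¹' Ω)) :=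
    hg.comp_measurePreserving (hT.restrict_preimage Ω)
  refine h2.of_le_mul (hT.aestronglyMeasurable_pullbackGrad hg.1) (c := M) ?_
  refine (ae_restrict_mem (hT.contDiff.continuous.measurable hΩ)).mono fun x hx => ?_
  exact norm_pullbackGrad_le (hM x hx)

/-! ### Limits of `L²` pairings, and a concrete mollifying sequence. -/

lemma integrable_inner_of_memLp_two {α E : Type*} [MeasurableSpace α] {ν : Measure α}
    [NormedAddCommGroup E] [InnerProductSpace ℝ E] {f g : α → E}
    (hf : MemLp f 2 ν) (hg : MemLp g 2 ν) : Integrable (fun x => inner ℝ (f x) (g x)) ν := by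
  refine (hf.norm.integrable_mul hg.norm).mono' (hf.1.inner hg.1) ?_
  exact Eventually.of_forall fun x => norm_inner_le_norm _ _

lemma eLpNorm_inner_le {α E : Type*} [MeasurableSpace α] {ν : Measure α}
    [NormedAddCommGroup E] [InnerProductSpace ℝ E] {f g : α → E}
    (hf : AEStronglyMeasurable f ν) (hg : AEStronglyMeasurable g ν) :
    eLpNorm (fun x => (inner ℝ (f x) (g x) : ℝ)) 1 ν ≤ eLpNorm f 2 ν * eLpNorm g 2 ν := by
  have h1 := eLpNorm_le_eLpNorm_mul_eLpNorm_of_nnnorm (p := 2) (q := 2) (r := 1)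
    hf hg (fun a b : E => (inner ℝ a b : ℝ)) 1
    (Eventually.of_forall fun x => by
      rw [one_mul]
      exact nnnorm_inner_le_nnnorm (𝕜 := ℝ) _ _)
  rwa [ENNReal.coe_one, one_mul] at h1

lemma tendsto_integral_inner_of_eLpNorm {α E : Type*} [MeasurableSpace α] {ν : Measure α}
    [NormedAddCommGroup E] [InnerProductSpace ℝ E] {h : ℕ → α → E} {h₀ m : α → E}
    (hh : ∀ k, MemLp (h k) 2 ν) (hh₀ : MemLp h₀ 2 ν) (hm : MemLp m 2 ν)
    (ht : Tendsto (fun k => eLpNorm (fun x => h k x - h₀ x) 2 ν) atTop (𝓝 0)) :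
    Tendsto (fun k => ∫ x, inner ℝ (h k x) (m x) ∂ν) atTop (𝓝 (∫ x, inner ℝ (h₀ x) (m x) ∂ν)) := by
  have hb : Tendsto (fun k => eLpNorm (fun x => h k x - h₀ x) 2 ν * eLpNorm m 2 ν) atTop (𝓝 0) := by
    have := ENNReal.Tendsto.mul_const ht (Or.inr hm.eLpNorm_ne_top)
    rwa [zero_mul] at this
  have hl : Tendsto (fun k => eLpNorm ((fun x => (inner ℝ (h k x) (m x) : ℝ)) -
      fun x => (inner ℝ (h₀ x) (m x) : ℝ)) 1 ν) atTop (𝓝 0) := by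
    refine tendsto_of_tendsto_of_tendsto_of_le_of_le tendsto_const_nhds hb (fun _ => zero_le) ?_
    intro k
    have e1 : ((fun x => (inner ℝ (h k x) (m x) : ℝ)) - fun x => (inner ℝ (h₀ x) (m x) : ℝ))
        = fun x => (inner ℝ (h k x - h₀ x) (m x) : ℝ) := by
      funext x
      exact (inner_sub_left _ _ _).symm
    beta_reduce
    rw [e1]
    exact eLpNorm_inner_le ((hh k).sub hh₀).1 hm.1
  exact tendsto_integral_of_L1' _ (integrable_inner_of_memLp_two hh₀ hm).1
    (Eventually.of_forall fun k => integrable_inner_of_memLp_two (hh k) hm) hl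

/-- A sequence of bump functions with supports shrinking to the origin. -/
noncomputable def bumpSeq (k : ℕ) : ContDiffBump (0 : Plane) where
  rIn := 1 / ((k : ℝ) + 1) / 2
  rOut := 1 / ((k : ℝ) + 1)
  rIn_pos := by positivity
  rIn_lt_rOut := half_lt_self (by positivity)

lemma tendsto_bumpSeq_rOut : Tendsto (fun k => (bumpSeq k).rOut) atTop (𝓝 0) :=
  tendsto_one_div_add_atTop_nhds_zero_nat

lemma memLp_indicator_of_restrict {E : Type*} [NormedAddCommGroup E] {Ω : Set Plane}
    (hΩ : MeasurableSet Ω) {h : Plane → E} (hh : MemLp h 2 (volume.restrict Ω)) :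
    MemLp (Ω.indicator h) 2 volume := (memLp_indicator_iff_restrict hΩ).2 hh

lemma tendsto_eLpNorm_mollify_indicator {E : Type*} [NormedAddCommGroup E] [NormedSpace ℝ E]
    [CompleteSpace E] {Ω : Set Plane} (hΩ : MeasurableSet Ω) (hb : Bornology.IsBounded Ω)
    {h : Plane → E} (hh : MemLp h 2 (volume.restrict Ω)) {r : ℕ → ℝ} (hr : Tendsto r atTop (𝓝 1)) :
    Tendsto (fun k => eLpNorm (fun x => mollify (bumpSeq k) (Ω.indicator h) (r k • x) - h x) 2
      (volume.restrict Ω)) atTop (𝓝 0) := by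
  obtain ⟨R, hR⟩ := hb.subset_ball (0 : Plane)
  have h1 := tendsto_eLpNorm_mollify_comp_smul tendsto_bumpSeq_rOut hr
    (memLp_indicator_of_restrict hΩ hh) R
  refine tendsto_of_tendsto_of_tendsto_of_le_of_le tendsto_const_nhds h1 (fun _ => zero_le) ?_
  intro k
  refine le_trans (le_of_eq ?_) (eLpNorm_mono_measure _ (Measure.restrict_mono hR le_rfl))
  refine eLpNorm_congr_ae ((ae_restrict_mem hΩ).mono fun x hx => ?_)
  simp [hx]

/-- Test functions cannot be moved to `Ω`, since `φ ∘ T⁻¹` is only `C¹`. Instead `u` is mollified to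
`V k`: classical integration by parts holds for `V k ∘ T`, and both sides converge because
composition with the measure-preserving `T` keeps `L²` distances. -/
lemma IsVolumeDiffeo.isWeakGrad_comp {T : Plane ≃ Plane} (hT : IsVolumeDiffeo T)
    {Ω : Set Plane} (hΩ : IsOpen Ω) (hb : Bornology.IsBounded Ω) {u : Plane → ℝ}
    {g : Plane → Plane} (hu : MemLp u 2 (volume.restrict Ω)) (hg : MemLp g 2 (volume.restrict Ω))
    (h : IsWeakGrad Ω u g) : IsWeakGrad (T ⁻¹' Ω) (u ∘ T) (pullbackGrad T g) := by
  have hΩ' : IsOpen (T ⁻¹' Ω) := hΩ.preimage hT.contDiff.continuous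
  have hb' := hT.isBounded_preimage hb
  have : IsFiniteMeasure (volume.restrict (T ⁻¹' Ω)) := ⟨by simpa using hb'.measure_lt_top⟩
  have hmp := hT.restrict_preimage Ω
  have huT : MemLp (u ∘ T) 2 (volume.restrict (T ⁻¹' Ω)) := hu.comp_measurePreserving hmp
  have hgT : MemLp (g ∘ T) 2 (volume.restrict (T ⁻¹' Ω)) := hg.comp_measurePreserving hmp
  have hpT := hT.memLp_pullbackGrad hΩ.measurableSet hb hg
  refine ⟨IntegrableOn.locallyIntegrableOn (huT.integrable (by norm_num)),
    IntegrableOn.locallyIntegrableOn (hpT.integrable (by norm_num)), fun φ hφ hc hs e => ?_⟩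
  have hφ1 : ContDiff ℝ 1 φ := hφ.of_le (by simp)
  set U := Ω.indicator u
  set G := Ω.indicator g
  have hU := memLp_indicator_of_restrict hΩ.measurableSet hu
  have hG := memLp_indicator_of_restrict hΩ.measurableSet hg
  have hUl : LocallyIntegrable U := hU.locallyIntegrable (by norm_num)
  have hGl : LocallyIntegrable G := hG.locallyIntegrable (by norm_num)
  set V : ℕ → Plane → ℝ := fun k => mollify (bumpSeq k) U
  set W : ℕ → Plane → Plane := fun k => mollify (bumpSeq k) G
  have hV : ∀ k, ContDiff ℝ 1 (V k) := fun k => contDiff_mollify (n := 1) _ hUl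
  have hW : ∀ k, ContDiff ℝ 1 (W k) := fun k => contDiff_mollify (n := 1) _ hGl
  have hVm : ∀ k, MemLp (V k ∘ T) 2 (volume.restrict (T ⁻¹' Ω)) := fun k =>
    MemLp.comp_measurePreserving (μ := volume.restrict (T ⁻¹' Ω)) (ν := volume.restrict Ω)
      (MemLp.restrict Ω ⟨(hV k).continuous.aestronglyMeasurable,
        (eLpNorm_mollify_le _ hU.1).trans_lt hU.2⟩) hmp
  have hWm : ∀ k, MemLp (W k ∘ T) 2 (volume.restrict (T ⁻¹' Ω)) := fun k =>
    MemLp.comp_measurePreserving (μ := volume.restrict (T ⁻¹' Ω)) (ν := volume.restrict Ω)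
      (MemLp.restrict Ω ⟨(hW k).continuous.aestronglyMeasurable,
        (eLpNorm_mollify_le _ hG.1).trans_lt hG.2⟩) hmp
  have hDφ : MemLp (fun x => fderiv ℝ φ x e) 2 (volume.restrict (T ⁻¹' Ω)) :=
    ((continuous_fderiv_apply_const hφ1 e).memLp_of_hasCompactSupport
      (hasCompactSupport_fderiv_apply hc e)).restrict _
  have hDTc : Continuous fun x => φ x • fderiv ℝ T x e :=
    hφ.continuous.smul ((hT.contDiff.continuous_fderiv one_ne_zero).clm_apply continuous_const)
  have hDT : MemLp (fun x => φ x • fderiv ℝ T x e) 2 (volume.restrict (T ⁻¹' Ω)) :=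
    (hDTc.memLp_of_hasCompactSupport hc.smul_right).restrict _
  have tV : Tendsto (fun k => eLpNorm (fun x => (V k ∘ T) x - (u ∘ T) x) 2
      (volume.restrict (T ⁻¹' Ω))) atTop (𝓝 0) := by
    have h1 := tendsto_eLpNorm_mollify_indicator hΩ.measurableSet hb hu
      (tendsto_const_nhds (x := (1 : ℝ)))
    refine h1.congr fun k => ?_
    simp only [one_smul]
    exact (eLpNorm_comp_measurePreserving
      (((hV k).continuous.aestronglyMeasurable).sub hu.1) hmp).symm
  have tW : Tendsto (fun k => eLpNorm (fun x => (W k ∘ T) x - (g ∘ T) x) 2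
      (volume.restrict (T ⁻¹' Ω))) atTop (𝓝 0) := by
    have h1 := tendsto_eLpNorm_mollify_indicator hΩ.measurableSet hb hg
      (tendsto_const_nhds (x := (1 : ℝ)))
    refine h1.congr fun k => ?_
    simp only [one_smul]
    exact (eLpNorm_comp_measurePreserving
      (((hW k).continuous.aestronglyMeasurable).sub hg.1) hmp).symm
  have lim1 := tendsto_integral_inner_of_eLpNorm hVm huT hDφ tV
  have lim2 := (tendsto_integral_inner_of_eLpNorm hWm hgT hDT tW).neg
  -- The compact set `T (tsupport φ)` has positive distance to the complement of `Ω`. Once the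
  -- mollification radius is below `δ`, the gradient of `V k` equals `W k` at every point of it; off
  -- `tsupport φ` both integrands vanish.
  obtain ⟨δ, hδ, hδΩ⟩ := (hc.isCompact.image hT.contDiff.continuous).exists_cthickening_subset_open
    hΩ (image_subset_iff.2 hs)
  have ev : ∀ᶠ k in atTop, (∫ x in T ⁻¹' Ω, inner ℝ ((V k ∘ T) x) (fderiv ℝ φ x e))
      = - ∫ x in T ⁻¹' Ω, inner ℝ ((W k ∘ T) x) (φ x • fderiv ℝ T x e) := by
    filter_upwards [tendsto_bumpSeq_rOut.eventually_lt_const hδ] with k hk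
    have hf : ContDiff ℝ 1 (V k ∘ T) := (hV k).comp hT.contDiff
    have ibp := integral_mul_fderiv_eq_neg_fderiv_mul_of_integrable
      (μ := (volume : Measure Plane)) (f := V k ∘ T) (g := φ) (v := e)
      (((continuous_fderiv_apply_const hf e).mul hφ.continuous).integrable_of_hasCompactSupport
        hc.mul_left)
      ((hf.continuous.mul (continuous_fderiv_apply_const hφ1 e)).integrable_of_hasCompactSupport
        (hasCompactSupport_fderiv_apply hc e).mul_left)
      ((hf.continuous.mul hφ.continuous).integrable_of_hasCompactSupport hc.mul_left)
      (fun x _ => (hf.differentiable one_ne_zero) x) (fun x _ => (hφ1.differentiable one_ne_zero) x)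
    rw [setIntegral_eq_integral_of_forall_compl_eq_zero,
      setIntegral_eq_integral_of_forall_compl_eq_zero]
    · have e1 : ∀ x, inner ℝ ((V k ∘ T) x) (fderiv ℝ φ x e) = (V k ∘ T) x * fderiv ℝ φ x e :=
        fun x => by simp [mul_comm]
      have e2 : ∀ x, inner ℝ ((W k ∘ T) x) (φ x • fderiv ℝ T x e)
          = fderiv ℝ (V k ∘ T) x e * φ x := by
        intro x
        by_cases hx : x ∈ tsupport φ
        · rw [fderiv_comp x ((hV k).differentiable one_ne_zero _)
            (hT.contDiff.differentiable one_ne_zero _), real_inner_smul_right, mul_comm]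
          congr 1
          refine (h.fderiv_mollify_indicator hΩ.measurableSet hUl hGl (bumpSeq k) ?_ _).symm
          refine (Metric.closedBall_subset_closedBall hk.le).trans (Subset.trans ?_ hδΩ)
          exact Metric.closedBall_subset_cthickening (mem_image_of_mem T hx) δ
        · simp [image_eq_zero_of_notMem_tsupport hx]
      simp only [e1, e2]
      exact ibp
    · intro x hx
      simp [image_eq_zero_of_notMem_tsupport (fun h' => hx (hs h'))]
    · intro x hx
      rw [image_eq_zero_of_notMem_tsupport (f := fun x => fderiv ℝ φ x e)
        (fun h' => hx (hs (tsupport_fderiv_apply_subset φ e h')))]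
      simp
  have := tendsto_nhds_unique (lim1.congr' ev) lim2
  refine Eq.trans (integral_congr_ae (Eventually.of_forall fun x => ?_))
    (this.trans (congrArg Neg.neg (integral_congr_ae (Eventually.of_forall fun x => ?_))))
  · simp [mul_comm]
  · simp only [pullbackGrad, ContinuousLinearMap.adjoint_inner_left, real_inner_smul_right,
      Function.comp_apply, mul_comm]

lemma IsVolumeDiffeo.memH1_comp {T : Plane ≃ Plane} (hT : IsVolumeDiffeo T)
    {Ω : Set Plane} (hΩ : IsOpen Ω) (hb : Bornology.IsBounded Ω) {u : Plane → ℝ}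
    (hu : MemH1 Ω u) : MemH1 (T ⁻¹' Ω) (u ∘ T) :=
  ⟨hu.1.comp_measurePreserving (hT.restrict_preimage Ω), _,
    hT.memLp_pullbackGrad hΩ.measurableSet hb (hu.memLp_weakGrad hΩ),
    hT.isWeakGrad_comp hΩ hb hu.1 (hu.memLp_weakGrad hΩ) hu.isWeakGrad⟩

lemma IsVolumeDiffeo.weakGrad_comp {T : Plane ≃ Plane} (hT : IsVolumeDiffeo T)
    {Ω : Set Plane} (hΩ : IsOpen Ω) (hb : Bornology.IsBounded Ω) {u : Plane → ℝ}
    (hu : MemH1 Ω u) : weakGrad (T ⁻¹' Ω) (u ∘ T) =ᵐ[volume.restrict (T ⁻¹' Ω)]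
      pullbackGrad T (weakGrad Ω u) :=
  (hT.isWeakGrad_comp hΩ hb hu.1 (hu.memLp_weakGrad hΩ) hu.isWeakGrad).ae_eq_weakGrad
    (hΩ.preimage hT.contDiff.continuous)

end Pullback

section ArcLength

/-! ### Arc length of `C¹` curves -/

open scoped NNReal ENNReal

section Curve

variable {γ : ℝ → Plane}

/-- On `E` the curve is within `ε` of an affine map with velocity `v`, so it is Lipschitz with
constant `‖v‖ + ε`. -/
lemma hausdorffMeasure_image_le_of_approx {E : Set ℝ} {v : Plane} {ε : ℝ} (hε : 0 ≤ ε)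
    (h : ∀ s ∈ E, ∀ t ∈ E, ‖γ s - γ t - (s - t) • v‖ ≤ ε * |s - t|) :
    μH[1] (γ '' E) ≤ ENNReal.ofReal (‖v‖ + ε) * volume E := by
  have hl : LipschitzOnWith (Real.toNNReal (‖v‖ + ε)) γ E := by
    refine LipschitzOnWith.of_dist_le_mul fun s hs t ht => ?_
    rw [Real.coe_toNNReal _ (by positivity), dist_eq_norm, Real.dist_eq]
    calc ‖γ s - γ t‖ = ‖(γ s - γ t - (s - t) • v) + (s - t) • v‖ := by rw [sub_add_cancel]
      _ ≤ ε * |s - t| + |s - t| * ‖v‖ := by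
        refine (norm_add_le _ _).trans (add_le_add (h s hs t ht) ?_)
        rw [norm_smul, Real.norm_eq_abs]
      _ = _ := by ring
  have := hl.hausdorffMeasure_image_le (d := 1) zero_le_one
  rwa [ENNReal.rpow_one, hausdorffMeasure_real] at this

/-- When `‖v‖ > ε`, the curve is injective on `E` with inverse Lipschitz of constant `(‖v‖ - ε)⁻¹`;
apply the Lipschitz bound to that inverse. Otherwise the left side is zero. -/
lemma le_hausdorffMeasure_image_of_approx {E : Set ℝ} {v : Plane} {ε : ℝ}
    (h : ∀ s ∈ E, ∀ t ∈ E, ‖γ s - γ t - (s - t) • v‖ ≤ ε * |s - t|) :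
    ENNReal.ofReal (‖v‖ - ε) * volume E ≤ μH[1] (γ '' E) := by
  rcases le_or_gt (‖v‖ - ε) 0 with h0 | h0
  · rw [ENNReal.ofReal_of_nonpos h0, zero_mul]
    exact zero_le
  have key : ∀ s ∈ E, ∀ t ∈ E, (‖v‖ - ε) * |s - t| ≤ ‖γ s - γ t‖ := by
    intro s hs t ht
    have h1 := h s hs t ht
    have h2 : ‖(s - t) • v‖ ≤ ‖γ s - γ t‖ + ‖γ s - γ t - (s - t) • v‖ := by
      have := norm_sub_le (γ s - γ t) (γ s - γ t - (s - t) • v)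
      rwa [sub_sub_cancel] at this
    rw [norm_smul, Real.norm_eq_abs] at h2
    linarith
  have hinj : InjOn γ E := by
    intro s hs t ht hst
    have := key s hs t ht
    rw [hst, sub_self, norm_zero] at this
    have h3 : |s - t| ≤ 0 := by
      by_contra h4
      push Not at h4
      exact absurd this (not_le.2 (mul_pos h0 h4))
    exact sub_eq_zero.1 (abs_nonpos_iff.1 h3)
  set g := Function.invFunOn γ E
  have hg : ∀ s ∈ E, g (γ s) = s := fun s hs => hinj.leftInvOn_invFunOn hs
  have hl : LipschitzOnWith (Real.toNNReal (‖v‖ - ε)⁻¹) g (γ '' E) := by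
    refine LipschitzOnWith.of_dist_le_mul ?_
    rintro _ ⟨s, hs, rfl⟩ _ ⟨t, ht, rfl⟩
    rw [Real.coe_toNNReal _ (by positivity), hg s hs, hg t ht, dist_eq_norm (γ s), Real.dist_eq,
      inv_mul_eq_div, le_div_iff₀ h0, mul_comm]
    exact key s hs t ht
  have h5 := hl.hausdorffMeasure_image_le (d := 1) zero_le_one
  have h6 : g '' (γ '' E) = E := by
    rw [image_image]
    exact (image_congr hg).trans (image_id' E)
  rw [h6, ENNReal.rpow_one, hausdorffMeasure_real] at h5
  calc ENNReal.ofReal (‖v‖ - ε) * volume E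
      ≤ ENNReal.ofReal (‖v‖ - ε) * (ENNReal.ofReal (‖v‖ - ε)⁻¹ * μH[1] (γ '' E)) := by
        gcongr
        exact h5
    _ = μH[1] (γ '' E) := by
        rw [← mul_assoc, ← ENNReal.ofReal_mul h0.le, mul_inv_cancel₀ h0.ne', ENNReal.ofReal_one,
          one_mul]

/-- Both quantities lie between `(‖v‖ - ε)` and `(‖v‖ + ε)` times the length of `E` (the lower
factor truncated at zero), hence differ by at most `2 * ε` times that length. -/
lemma hausdorffMeasure_image_compare {E : Set ℝ} (hE : MeasurableSet E)
    {γ' : ℝ → Plane} {v : Plane} {ε : ℝ} (hε : 0 ≤ ε)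
    (h : ∀ s ∈ E, ∀ t ∈ E, ‖γ s - γ t - (s - t) • v‖ ≤ ε * |s - t|)
    (h' : ∀ t ∈ E, ‖γ' t - v‖ ≤ ε) :
    μH[1] (γ '' E) ≤ (∫⁻ t in E, ‖γ' t‖ₑ) + ENNReal.ofReal (2 * ε) * volume E ∧
    (∫⁻ t in E, ‖γ' t‖ₑ) ≤ μH[1] (γ '' E) + ENNReal.ofReal (2 * ε) * volume E := by
  have n1 : ∀ t ∈ E, ‖γ' t‖ ≤ ‖v‖ + ε := fun t ht => by
    have := norm_sub_norm_le (γ' t) v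
    linarith [h' t ht]
  have n2 : ∀ t ∈ E, ‖v‖ - ε ≤ ‖γ' t‖ := fun t ht => by
    have := norm_sub_norm_le v (γ' t)
    rw [norm_sub_rev] at this
    linarith [h' t ht]
  have hsplit : ENNReal.ofReal (‖v‖ + ε) ≤ ENNReal.ofReal (‖v‖ - ε) + ENNReal.ofReal (2 * ε) := by
    refine le_trans (ENNReal.ofReal_le_ofReal ?_) ENNReal.ofReal_add_le
    linarith
  have i1 : (∫⁻ t in E, ‖γ' t‖ₑ) ≤ ENNReal.ofReal (‖v‖ + ε) * volume E := by
    rw [← setLIntegral_const]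
    refine setLIntegral_mono' hE fun t ht => ?_
    rw [← ofReal_norm]
    exact ENNReal.ofReal_le_ofReal (n1 t ht)
  have i2 : ENNReal.ofReal (‖v‖ - ε) * volume E ≤ (∫⁻ t in E, ‖γ' t‖ₑ) := by
    rw [← setLIntegral_const]
    refine setLIntegral_mono' hE fun t ht => ?_
    rw [← ofReal_norm]
    exact ENNReal.ofReal_le_ofReal (n2 t ht)
  have hs2 : ENNReal.ofReal (‖v‖ + ε) * volume E ≤
      ENNReal.ofReal (‖v‖ - ε) * volume E + ENNReal.ofReal (2 * ε) * volume E := by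
    rw [← add_mul]
    gcongr
  exact ⟨(hausdorffMeasure_image_le_of_approx hε h).trans (hs2.trans (by gcongr)),
    i1.trans (hs2.trans (add_le_add (le_hausdorffMeasure_image_of_approx h) le_rfl))⟩

/-- By uniform continuity, `deriv γ` varies by at most `ε` on each cell of length `δ`. Take for `v`
its value at one point of the cell and apply the mean value inequality to `γ x - x • v`. -/
lemma exists_cell_approx (hγ : ContDiff ℝ 1 γ) (a b : ℝ) {ε : ℝ} (hε : 0 < ε) :
    ∃ δ : ℝ, 0 < δ ∧ ∀ c : ℝ, ∃ v : Plane,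
      (∀ s ∈ Ico a b ∩ Ico c (c + δ), ∀ t ∈ Ico a b ∩ Ico c (c + δ),
        ‖γ s - γ t - (s - t) • v‖ ≤ ε * |s - t|) ∧
      ∀ t ∈ Ico a b ∩ Ico c (c + δ), ‖deriv γ t - v‖ ≤ ε := by
  have hc : ContinuousOn (deriv γ) (Icc a b) := (hγ.continuous_deriv le_rfl).continuousOn
  obtain ⟨δ, hδ, hu⟩ := Metric.uniformContinuousOn_iff_le.1
    (isCompact_Icc.uniformContinuousOn_of_continuous hc) ε hε
  refine ⟨δ, hδ, fun c => ?_⟩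
  rcases (Ico a b ∩ Ico c (c + δ)).eq_empty_or_nonempty with h0 | ⟨t₀, ht₀⟩
  · exact ⟨0, by simp [h0]⟩
  have hd : ∀ t ∈ Ico a b ∩ Ico c (c + δ), ‖deriv γ t - deriv γ t₀‖ ≤ ε := by
    intro t ht
    rw [← dist_eq_norm]
    refine hu t (Ico_subset_Icc_self ht.1) t₀ (Ico_subset_Icc_self ht₀.1) ?_
    rw [Real.dist_eq, abs_le]
    have h1 := ht.2.1; have h2 := ht.2.2; have h3 := ht₀.2.1; have h4 := ht₀.2.2
    constructor <;> linarith
  refine ⟨deriv γ t₀, fun s hs t ht => ?_, hd⟩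
  have hconv : Convex ℝ (Ico a b ∩ Ico c (c + δ)) := (convex_Ico a b).inter (convex_Ico _ _)
  have hdiff : ∀ x, HasDerivAt γ (deriv γ x) x :=
    fun x => (hγ.differentiable one_ne_zero x).hasDerivAt
  have := hconv.norm_image_sub_le_of_norm_hasDerivWithin_le (f := fun x => γ x - x • deriv γ t₀)
    (f' := fun x => deriv γ x - deriv γ t₀) (C := ε)
    (fun x _ => by
      have h1 := (hdiff x).sub ((hasDerivAt_id x).smul_const (deriv γ t₀))
      rw [one_smul] at h1
      exact h1.hasDerivWithinAt) hd ht hs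
  rw [Real.norm_eq_abs] at this
  have heq : γ s - γ t - (s - t) • deriv γ t₀
      = γ s - s • deriv γ t₀ - (γ t - t • deriv γ t₀) := by
    rw [sub_smul]
    abel
  rwa [heq]

/-- Cut `E` along a grid of mesh `δ` and add the cellwise comparisons: the errors sum to `2 * ε *
volume E`, and `ε` is arbitrary. -/
lemma hausdorffMeasure_image_eq_lintegral (hγ : ContDiff ℝ 1 γ) {a b : ℝ}
    (hinj : InjOn γ (Ico a b)) {E : Set ℝ} (hE : MeasurableSet E) (hEs : E ⊆ Ico a b) :
    μH[1] (γ '' E) = ∫⁻ t in E, ‖deriv γ t‖ₑ := by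
  have hvol : volume E ≠ ⊤ := ((measure_mono hEs).trans_lt (by simp)).ne
  have key : ∀ ε : ℝ, 0 < ε →
      μH[1] (γ '' E) ≤ (∫⁻ t in E, ‖deriv γ t‖ₑ) + ENNReal.ofReal (2 * ε) * volume E ∧
      (∫⁻ t in E, ‖deriv γ t‖ₑ) ≤ μH[1] (γ '' E) + ENNReal.ofReal (2 * ε) * volume E := by
    intro ε hε
    obtain ⟨δ, hδ, hcell⟩ := exists_cell_approx hγ a b hε
    set I : ℤ → Set ℝ := fun n => Ico (n • δ) ((n + 1) • δ)
    have hIeq : ∀ n, I n = Ico (n • δ) (n • δ + δ) := fun n => by simp only [I, add_smul, one_smul]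
    set S : ℤ → Set ℝ := fun n => E ∩ I n
    have hS : ∀ n, MeasurableSet (S n) := fun n => hE.inter measurableSet_Ico
    have hSE : ⋃ n, S n = E := by
      rw [← inter_iUnion, iUnion_Ico_zsmul hδ, inter_univ]
    have hSd : Pairwise (Function.onFun Disjoint S) := fun m n hmn =>
      (pairwise_disjoint_Ico_zsmul δ hmn).mono inter_subset_right inter_subset_right
    have hSs : ∀ n, S n ⊆ Ico a b := fun n => inter_subset_left.trans hEs
    have hcmp : ∀ n, μH[1] (γ '' S n) ≤ (∫⁻ t in S n, ‖deriv γ t‖ₑ)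
          + ENNReal.ofReal (2 * ε) * volume (S n) ∧
        (∫⁻ t in S n, ‖deriv γ t‖ₑ) ≤ μH[1] (γ '' S n)
          + ENNReal.ofReal (2 * ε) * volume (S n) := fun n => by
      obtain ⟨v, hv1, hv2⟩ := hcell (n • δ)
      have hsub : S n ⊆ Ico a b ∩ Ico (n • δ) (n • δ + δ) := by
        rw [← hIeq]
        exact inter_subset_inter_left _ hEs
      exact hausdorffMeasure_image_compare (hS n) hε.le
        (fun s hs t ht => hv1 s (hsub hs) t (hsub ht)) (fun t ht => hv2 t (hsub ht))
    have v1 : volume E = ∑' n, volume (S n) := by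
      rw [← measure_iUnion hSd hS, hSE]
    have v2 : (∫⁻ t in E, ‖deriv γ t‖ₑ) = ∑' n, ∫⁻ t in S n, ‖deriv γ t‖ₑ := by
      rw [← lintegral_iUnion hS hSd, hSE]
    -- Injectivity enters here: it makes the images of the cells disjoint, and Borel as injective
    -- continuous images of Borel sets.
    have v3 : μH[1] (γ '' E) = ∑' n, μH[1] (γ '' S n) := by
      rw [← measure_iUnion, ← image_iUnion, hSE]
      · intro m n hmn
        exact (hSd hmn).image hinj (hSs m) (hSs n)
      · exact fun n => (hS n).image_of_continuousOn_injOn hγ.continuous.continuousOn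
          (hinj.mono (hSs n))
    rw [v1, v2, v3, ← ENNReal.tsum_mul_left, ← ENNReal.tsum_add, ← ENNReal.tsum_add]
    exact ⟨ENNReal.tsum_le_tsum fun n => (hcmp n).1, ENNReal.tsum_le_tsum fun n => (hcmp n).2⟩
  have small : ∀ η : ℝ≥0, 0 < η → ∃ ε : ℝ, 0 < ε ∧ ENNReal.ofReal (2 * ε) * volume E ≤ η := by
    intro η hη
    obtain ⟨n, hn, hn'⟩ := ENNReal.exists_nnreal_pos_mul_lt hvol
      (ENNReal.coe_ne_zero.2 hη.ne')
    refine ⟨n / 2, by positivity, ?_⟩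
    rw [mul_div_cancel₀ _ two_ne_zero, ENNReal.ofReal_coe_nnreal]
    exact hn'.le
  refine le_antisymm ?_ ?_
  · refine ENNReal.le_of_forall_pos_le_add fun η hη _ => ?_
    obtain ⟨ε, hε, hle⟩ := small η hη
    exact (key ε hε).1.trans (by gcongr)
  · refine ENNReal.le_of_forall_pos_le_add fun η hη _ => ?_
    obtain ⟨ε, hε, hle⟩ := small η hη
    exact (key ε hε).2.trans (by gcongr)

/-- **Area formula** for an injective `C¹` curve. -/
lemma restrict_hausdorffMeasure_image (hγ : ContDiff ℝ 1 γ) {a b : ℝ}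
    (hinj : InjOn γ (Ico a b)) :
    (μH[1] : Measure Plane).restrict (γ '' Ico a b)
      = ((volume.restrict (Ico a b)).withDensity fun t => ‖deriv γ t‖ₑ).map γ := by
  ext S hS
  have hm : MeasurableSet (γ ⁻¹' S) := hγ.continuous.measurable hS
  rw [Measure.restrict_apply hS, Measure.map_apply hγ.continuous.measurable hS,
    withDensity_apply _ hm, Measure.restrict_restrict hm, inter_comm S,
    ← image_inter_preimage, inter_comm,
    hausdorffMeasure_image_eq_lintegral hγ hinj (hm.inter measurableSet_Ico) inter_subset_right]

end Curve

end ArcLength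

section Disk

/-! ### The unit circle -/

open Real in
/-- The arc length parametrization of the unit circle. -/
noncomputable def circleCurve (t : ℝ) : Plane := !₂[cos t, sin t]

/-- Rotation by a right angle, which maps the normal of the unit circle to its tangent. -/
noncomputable def rot (x : Plane) : Plane := !₂[-x 1, x 0]

lemma contDiff_circleCurve : ContDiff ℝ ∞ circleCurve := by
  rw [contDiff_euclidean]
  intro i
  fin_cases i
  · exact Real.contDiff_cos
  · exact Real.contDiff_sin

lemma hasDerivAt_circleCurve (t : ℝ) : HasDerivAt circleCurve (rot (circleCurve t)) t := by
  have h : HasDerivAt (fun t => ![Real.cos t, Real.sin t]) ![-Real.sin t, Real.cos t] t := by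
    rw [hasDerivAt_pi]
    intro i
    fin_cases i
    · exact Real.hasDerivAt_cos t
    · exact Real.hasDerivAt_sin t
  exact ((PiLp.continuousLinearEquiv 2 ℝ fun _ : Fin 2 => ℝ).symm.toContinuousLinearMap.hasFDerivAt
    ).comp_hasDerivAt t h

lemma norm_circleCurve (t : ℝ) : ‖circleCurve t‖ = 1 := by
  simp [EuclideanSpace.norm_eq, circleCurve]

lemma norm_rot (x : Plane) : ‖rot x‖ = ‖x‖ := by
  simp [EuclideanSpace.norm_eq, rot, add_comm]

lemma continuous_rot : Continuous rot := by
  unfold rot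
  fun_prop

lemma injOn_circleCurve : InjOn circleCurve (Ico (-Real.pi) Real.pi) := by
  intro s hs t ht hst
  have h0 : Real.cos s = Real.cos t := by simpa [circleCurve] using congrArg (fun x : Plane => x 0) hst
  have h1 : Real.sin s = Real.sin t := by simpa [circleCurve] using congrArg (fun x : Plane => x 1) hst
  obtain ⟨k, hk⟩ := Real.Angle.angle_eq_iff_two_pi_dvd_sub.1 (Real.Angle.cos_sin_inj h0 h1)
  have hpi := Real.pi_pos
  have k1 : (k : ℝ) < 1 := by
    by_contra h
    push Not at h
    nlinarith [hs.1, hs.2, ht.1, ht.2]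
  have k2 : (-1 : ℝ) < k := by
    by_contra h
    push Not at h
    nlinarith [hs.1, hs.2, ht.1, ht.2]
  have k0 : k = 0 := by
    have a1 : k < 1 := by exact_mod_cast k1
    have a2 : -1 < k := by exact_mod_cast k2
    omega
  rw [k0] at hk
  simp at hk
  linarith

lemma image_circleCurve : circleCurve '' Ico (-Real.pi) Real.pi = Metric.sphere 0 1 := by
  refine Subset.antisymm ?_ fun x hx => ?_
  · rintro _ ⟨t, -, rfl⟩
    simp [norm_circleCurve]
  · have hx1 : ‖x‖ = 1 := by simpa using hx
    have hx2 : x 0 ^ 2 + x 1 ^ 2 = 1 := by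
      have := EuclideanSpace.norm_sq_eq x
      rw [hx1] at this
      simpa [Fin.sum_univ_two] using this.symm
    -- The argument of a complex number lies in `(-π, π]`, whereas the parameter interval is `[-π,
    -- π)`; conjugating and negating the angle exchanges the two.
    set z : ℂ := ⟨x 0, -x 1⟩
    have hz : ‖z‖ = 1 := by
      rw [Complex.norm_eq_sqrt_sq_add_sq]
      simp [z, hx2]
    have hz0 : z ≠ 0 := by
      intro h
      simp [h] at hz
    refine ⟨-z.arg, ⟨?_, ?_⟩, ?_⟩
    · exact neg_le_neg (Complex.arg_le_pi z)
    · have := Complex.neg_pi_lt_arg z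
      linarith
    · ext i
      fin_cases i
      · simp [circleCurve, Complex.cos_arg hz0, hz, z]
      · simp [circleCurve, Complex.sin_arg, hz, z]

lemma frontier_disk : frontier disk = Metric.sphere (0 : Plane) 1 :=
  frontier_ball _ one_ne_zero

lemma bdry_disk : bdry disk = (volume.restrict (Ico (-Real.pi) Real.pi)).map circleCurve := by
  have h := restrict_hausdorffMeasure_image (contDiff_circleCurve.of_le (by simp)) injOn_circleCurve
  rw [bdry, frontier_disk, ← image_circleCurve, h]
  have h1 : (fun t => ‖deriv circleCurve t‖ₑ) = 1 := by
    funext t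
    rw [(hasDerivAt_circleCurve t).deriv, ← ofReal_norm, norm_rot, norm_circleCurve]
    simp
  rw [h1, withDensity_one]

instance isFiniteMeasure_bdry_disk : IsFiniteMeasure (bdry disk) := by
  rw [bdry_disk]
  infer_instance

lemma ae_bdry_disk_mem_sphere : ∀ᵐ x ∂(bdry disk), x ∈ Metric.sphere (0 : Plane) 1 := by
  rw [bdry, frontier_disk]
  exact ae_restrict_mem Metric.isClosed_sphere.measurableSet

lemma IsVolumeDiffeo.frontier_image {T : Plane ≃ Plane} (hT : IsVolumeDiffeo T) :
    frontier (T '' disk) = (T ∘ circleCurve) '' Ico (-Real.pi) Real.pi := by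
  rw [image_comp, image_circleCurve, ← frontier_disk]
  exact (hT.toHomeomorph.image_frontier disk).symm

/-- The boundary of the image is the curve `T ∘ circleCurve`, whose speed at `x` on the circle is
the norm of `DT` on the unit tangent `rot x`; the area formula turns this speed into the density. -/
lemma IsVolumeDiffeo.bdry_image {T : Plane ≃ Plane} (hT : IsVolumeDiffeo T) :
    bdry (T '' disk)
      = ((bdry disk).withDensity fun x => ‖fderiv ℝ T x (rot x)‖ₑ).map T := by
  have hc : ContDiff ℝ 1 circleCurve := contDiff_circleCurve.of_le (by simp)
  have h := restrict_hausdorffMeasure_image (hT.contDiff.comp hc)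
    (T.injective.comp_injOn injOn_circleCurve)
  have hm : Measurable fun x : Plane => ‖fderiv ℝ T x (rot x)‖ₑ :=
    ((hT.contDiff.continuous_fderiv one_ne_zero).clm_apply continuous_rot).enorm.measurable
  rw [bdry, hT.frontier_image, h, ← Measure.map_map hT.contDiff.continuous.measurable
    hc.continuous.measurable]
  congr 1
  ext S hS
  have hS' := hc.continuous.measurable hS
  rw [Measure.map_apply hc.continuous.measurable hS, withDensity_apply _ hS',
    withDensity_apply _ hS, bdry_disk, setLIntegral_map hS hm hc.continuous.measurable]
  refine lintegral_congr fun t => ?_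
  have h1 : HasDerivAt (T ∘ circleCurve) (fderiv ℝ T (circleCurve t) (rot (circleCurve t))) t :=
    ((hT.contDiff.differentiable one_ne_zero _).hasFDerivAt).comp_hasDerivAt t
      (hasDerivAt_circleCurve t)
  rw [h1.deriv]

/-! ### The divergence theorem for `x ↦ φ(x)² x` on the disk -/

lemma setIntegral_disk_eq_polar (F : Plane → ℝ) :
    ∫ x in disk, F x = ∫ p in Ioo (0 : ℝ) 1 ×ˢ Ioo (-Real.pi) Real.pi,
      p.1 * F (p.1 • circleCurve p.2) := by
  have e1 : MeasurePreserving (fun x : Plane => ((x 0, x 1) : ℝ × ℝ)) volume volume :=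
    (volume_preserving_finTwoArrow ℝ).comp
      (EuclideanSpace.volume_preserving_symm_measurableEquiv_toLp (Fin 2))
  set e : Plane ≃ᵐ ℝ × ℝ := (MeasurableEquiv.toLp 2 (Fin 2 → ℝ)).symm.trans
    MeasurableEquiv.finTwoArrow
  have e2 : MeasurePreserving e volume volume := e1
  have hes : ∀ p : ℝ × ℝ, e.symm p = !₂[p.1, p.2] := fun p => by
    rw [MeasurableEquiv.symm_apply_eq]
    simp [e]
  rw [← integral_indicator measurableSet_ball, ← (e2.symm e).integral_comp' (g := disk.indicator F),
    ← integral_comp_polarCoord_symm, polarCoord_target]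
  have hsub : Ioo (0 : ℝ) 1 ×ˢ Ioo (-Real.pi) Real.pi ⊆ Ioi 0 ×ˢ Ioo (-Real.pi) Real.pi :=
    prod_mono Ioo_subset_Ioi_self Subset.rfl
  have hpt : ∀ p : ℝ × ℝ, e.symm (polarCoord.symm p) = p.1 • circleCurve p.2 := fun p => by
    rw [hes, polarCoord_symm_apply]
    ext i
    fin_cases i <;> simp [circleCurve]
  have hin : ∀ p : ℝ × ℝ, 0 < p.1 → (p.1 • circleCurve p.2 ∈ disk ↔ p.1 < 1) := fun p hp => by
    rw [Metric.mem_ball, dist_zero_right, norm_smul, norm_circleCurve, mul_one,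
      Real.norm_of_nonneg hp.le]
  refine (setIntegral_eq_of_subset_of_forall_sdiff_eq_zero
    (measurableSet_Ioi.prod measurableSet_Ioo) hsub ?_).trans
    (setIntegral_congr_fun (measurableSet_Ioo.prod measurableSet_Ioo) fun p hp => ?_)
  · rintro p ⟨hp, hp'⟩
    have h1 : p.1 • circleCurve p.2 ∉ disk := fun h =>
      hp' ⟨⟨hp.1, (hin p hp.1).1 h⟩, hp.2⟩
    rw [hpt, indicator_of_notMem h1, smul_zero]
  · have := (hin p hp.1.1).2 hp.1.2
    simp only [hpt, indicator_of_mem this, smul_eq_mul]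

/-- In polar coordinates the integrand along the ray through `ξ`, with its Jacobian factor `r`, is
the derivative of `r² φ(rξ)²`. Integrating from `0` to `1` leaves the boundary value. -/
lemma integral_bdry_disk_sq {φ : Plane → ℝ} (hφ : ContDiff ℝ 1 φ) :
    ∫ x, φ x ^ 2 ∂(bdry disk) = ∫ x in disk, (2 * φ x ^ 2 + 2 * (φ x * fderiv ℝ φ x x)) := by
  have hcc : Continuous circleCurve := contDiff_circleCurve.continuous
  set F : Plane → ℝ := fun x => 2 * φ x ^ 2 + 2 * (φ x * fderiv ℝ φ x x) with hF
  have hDc : Continuous fun x : Plane => fderiv ℝ φ x x :=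
    (hφ.continuous_fderiv one_ne_zero).clm_apply continuous_id
  have hFc : Continuous F := by
    have := hφ.continuous
    fun_prop
  have hGc : Continuous fun p : ℝ × ℝ => p.1 * F (p.1 • circleCurve p.2) := by fun_prop
  have hint : IntegrableOn (fun p : ℝ × ℝ => p.1 * F (p.1 • circleCurve p.2))
      (Ioo (0 : ℝ) 1 ×ˢ Ioo (-Real.pi) Real.pi) :=
    (hGc.continuousOn.integrableOn_compact (isCompact_Icc.prod isCompact_Icc)).mono_set
      (prod_mono Ioo_subset_Icc_self Ioo_subset_Icc_self)
  have inner_eq : ∀ θ : ℝ, ∫ r in Ioo (0 : ℝ) 1, r * F (r • circleCurve θ)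
      = φ (circleCurve θ) ^ 2 := by
    intro θ
    set ξ := circleCurve θ
    have hd : ∀ r : ℝ, HasDerivAt (fun r : ℝ => r ^ 2 * φ (r • ξ) ^ 2) (r * F (r • ξ)) r := by
      intro r
      have h1 : HasDerivAt (fun r : ℝ => r • ξ) ξ r := by
        simpa using (hasDerivAt_id r).smul_const ξ
      have h2 : HasDerivAt (fun r : ℝ => φ (r • ξ)) (fderiv ℝ φ (r • ξ) ξ) r :=
        ((hφ.differentiable one_ne_zero _).hasFDerivAt).comp_hasDerivAt r h1
      have h3 := (hasDerivAt_pow 2 r).mul (h2.pow 2)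
      refine h3.congr_deriv ?_
      simp only [hF, map_smul, smul_eq_mul]
      simp
      ring
    rw [← integral_Ioc_eq_integral_Ioo, ← intervalIntegral.integral_of_le zero_le_one,
      intervalIntegral.integral_eq_sub_of_hasDerivAt (fun r _ => hd r)]
    · simp
    · exact (hGc.comp (continuous_id.prodMk continuous_const)).intervalIntegrable 0 1
  rw [setIntegral_disk_eq_polar F, Measure.volume_eq_prod, ← setIntegral_prod_swap,
    setIntegral_prod]
  · simp only [Prod.fst_swap, Prod.snd_swap, inner_eq]
    rw [bdry_disk, integral_map (f := fun x => φ x ^ 2) hcc.measurable.aemeasurable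
      (hφ.continuous.pow 2).aestronglyMeasurable, integral_Ico_eq_integral_Ioo]
  · exact IntegrableOn.swap hint

/-! ### Trace and Poincaré inequalities on the disk. -/

lemma eLpNorm_two_sq_eq_ofReal {α E : Type*} [MeasurableSpace α] [NormedAddCommGroup E]
    {μ : Measure α} {f : α → E} (hf : MemLp f 2 μ) :
    eLpNorm f 2 μ ^ 2 = ENNReal.ofReal (∫ x, ‖f x‖ ^ 2 ∂μ) := by
  rw [eLpNorm_two_sq, ofReal_integral_eq_lintegral_ofReal (hf.integrable_norm_pow two_ne_zero)
    (Eventually.of_forall fun x => by positivity)]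
  refine lintegral_congr fun x => ?_
  rw [ENNReal.ofReal_pow (norm_nonneg _), ofReal_norm]

lemma memLp_disk_of_continuous {E : Type*} [NormedAddCommGroup E] {f : Plane → E}
    (hf : Continuous f) : MemLp f 2 (volume.restrict disk) := by
  have : IsFiniteMeasure (volume.restrict disk) := ⟨by simp⟩
  obtain ⟨M, hM⟩ := (isCompact_closedBall (0 : Plane) 1).exists_bound_of_continuousOn
    hf.continuousOn
  refine MemLp.of_bound hf.aestronglyMeasurable M ?_
  exact (ae_restrict_mem measurableSet_ball).mono fun x hx => hM x (Metric.ball_subset_closedBall hx)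

lemma memLp_bdry_disk_of_continuous {E : Type*} [NormedAddCommGroup E] {f : Plane → E}
    (hf : Continuous f) : MemLp f 2 (bdry disk) := by
  obtain ⟨M, hM⟩ := (isCompact_sphere (0 : Plane) 1).exists_bound_of_continuousOn
    hf.continuousOn
  exact MemLp.of_bound hf.aestronglyMeasurable M (ae_bdry_disk_mem_sphere.mono hM)

lemma continuous_gradient {φ : Plane → ℝ} (hφ : ContDiff ℝ 1 φ) : Continuous (gradient φ) :=
  (InnerProductSpace.toDual ℝ Plane).symm.continuous.comp (hφ.continuous_fderiv one_ne_zero)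

lemma inner_gradient (φ : Plane → ℝ) (x e : Plane) : inner ℝ (gradient φ x) e = fderiv ℝ φ x e :=
  InnerProductSpace.toDual_symm_apply

lemma abs_two_mul_fderiv_self_le (φ : Plane → ℝ) {x : Plane} (hx : x ∈ disk) :
    |2 * (φ x * fderiv ℝ φ x x)| ≤ φ x ^ 2 + ‖gradient φ x‖ ^ 2 := by
  have hx1 : ‖x‖ ≤ 1 := by
    have : ‖x‖ < 1 := by simpa using hx
    exact this.le
  have h1 : |fderiv ℝ φ x x| ≤ ‖gradient φ x‖ := by
    rw [← inner_gradient]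
    refine (abs_real_inner_le_norm _ _).trans ?_
    exact mul_le_of_le_one_right (norm_nonneg _) hx1
  rw [abs_mul, abs_mul, abs_two]
  nlinarith [two_mul_le_add_sq |φ x| ‖gradient φ x‖, abs_nonneg (φ x), sq_abs (φ x)]

/-- The difference is the integral of `2 φ Dφ(x)x`, bounded by `φ² + |∇φ|²` since `|x| ≤ 1`. The
upper half of the estimate is the trace inequality with constant `3 = 2 + 1`; the lower half is the
Poincaré inequality with constant `1 = 2 - 1`. -/
lemma abs_integral_bdry_disk_sq_sub_le {φ : Plane → ℝ} (hφ : ContDiff ℝ 1 φ) :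
    |∫ x, φ x ^ 2 ∂(bdry disk) - 2 * ∫ x in disk, φ x ^ 2|
      ≤ (∫ x in disk, φ x ^ 2) + ∫ x in disk, ‖gradient φ x‖ ^ 2 := by
  have i1 : Integrable (fun x => φ x ^ 2) (volume.restrict disk) := by
    simpa using (memLp_disk_of_continuous hφ.continuous).integrable_norm_pow two_ne_zero
  have i2 : Integrable (fun x => ‖gradient φ x‖ ^ 2) (volume.restrict disk) :=
    (memLp_disk_of_continuous (continuous_gradient hφ)).integrable_norm_pow two_ne_zero
  have hbd : ∀ᵐ x ∂(volume.restrict disk), ‖2 * (φ x * fderiv ℝ φ x x)‖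
      ≤ φ x ^ 2 + ‖gradient φ x‖ ^ 2 :=
    (ae_restrict_mem measurableSet_ball).mono fun x hx => abs_two_mul_fderiv_self_le φ hx
  have hc : Continuous fun x : Plane => 2 * (φ x * fderiv ℝ φ x x) :=
    continuous_const.mul (hφ.continuous.mul
      ((hφ.continuous_fderiv one_ne_zero).clm_apply continuous_id))
  have i3 : IntegrableOn (fun x => 2 * (φ x * fderiv ℝ φ x x)) disk :=
    (i1.add i2).mono' hc.aestronglyMeasurable hbd
  rw [integral_bdry_disk_sq hφ, integral_add (i1.const_mul 2) i3, integral_const_mul,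
    add_sub_cancel_left, ← integral_add i1 i2]
  exact norm_integral_le_of_norm_le (i1.add i2) hbd

/-- The trace inequality for `C¹` functions on the disk. -/
lemma eLpNorm_bdry_disk_sq_le {φ : Plane → ℝ} (hφ : ContDiff ℝ 1 φ) :
    eLpNorm φ 2 (bdry disk) ^ 2 ≤ 3 * eLpNorm φ 2 (volume.restrict disk) ^ 2
      + eLpNorm (gradient φ) 2 (volume.restrict disk) ^ 2 := by
  rw [eLpNorm_two_sq_eq_ofReal (memLp_disk_of_continuous hφ.continuous),
    eLpNorm_two_sq_eq_ofReal (memLp_disk_of_continuous (continuous_gradient hφ)),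
    eLpNorm_two_sq_eq_ofReal (memLp_bdry_disk_of_continuous hφ.continuous),
    show (3 : ENNReal) = ENNReal.ofReal 3 by norm_num, ← ENNReal.ofReal_mul (by norm_num),
    ← ENNReal.ofReal_add (by positivity) (by positivity)]
  refine ENNReal.ofReal_le_ofReal ?_
  simp only [Real.norm_eq_abs, sq_abs]
  linarith [(abs_le.1 (abs_integral_bdry_disk_sq_sub_le hφ)).2]

/-- A Poincaré inequality for `C¹` functions on the disk. -/
lemma eLpNorm_disk_sq_le {φ : Plane → ℝ} (hφ : ContDiff ℝ 1 φ) :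
    eLpNorm φ 2 (volume.restrict disk) ^ 2 ≤ eLpNorm φ 2 (bdry disk) ^ 2
      + eLpNorm (gradient φ) 2 (volume.restrict disk) ^ 2 := by
  rw [eLpNorm_two_sq_eq_ofReal (memLp_disk_of_continuous hφ.continuous),
    eLpNorm_two_sq_eq_ofReal (memLp_disk_of_continuous (continuous_gradient hφ)),
    eLpNorm_two_sq_eq_ofReal (memLp_bdry_disk_of_continuous hφ.continuous),
    ← ENNReal.ofReal_add (by positivity) (by positivity)]
  refine ENNReal.ofReal_le_ofReal ?_
  simp only [Real.norm_eq_abs, sq_abs]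
  linarith [(abs_le.1 (abs_integral_bdry_disk_sq_sub_le hφ)).1]

end Disk

section DiskTrace

/-! ### Traces on the disk -/

open scoped ENNReal

lemma tendsto_zero_of_sq_tendsto_zero {ι : Type*} {l : Filter ι} {a : ι → ℝ≥0∞}
    (h : Tendsto (fun k => a k ^ 2) l (𝓝 0)) : Tendsto a l (𝓝 0) := by
  have h1 := (ENNReal.continuous_rpow_const (y := (1 / 2 : ℝ))).tendsto 0
  rw [ENNReal.zero_rpow_of_pos (by norm_num)] at h1
  refine (h1.comp h).congr fun k => ?_
  rw [Function.comp_apply, ← ENNReal.rpow_natCast, ← ENNReal.rpow_mul]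
  norm_num

lemma tendsto_eLpNorm_sub_sub {ι α E : Type*} [MeasurableSpace α] [NormedAddCommGroup E]
    {μ : Measure α} {l : Filter ι} {f g : ι → α → E} {u : α → E}
    (hf : ∀ k, AEStronglyMeasurable (f k) μ) (hg : ∀ k, AEStronglyMeasurable (g k) μ)
    (hu : AEStronglyMeasurable u μ)
    (hfu : Tendsto (fun k => eLpNorm (fun x => f k x - u x) 2 μ) l (𝓝 0))
    (hgu : Tendsto (fun k => eLpNorm (fun x => g k x - u x) 2 μ) l (𝓝 0)) :
    Tendsto (fun k => eLpNorm (fun x => f k x - g k x) 2 μ) l (𝓝 0) := by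
  have h := hfu.add hgu
  rw [add_zero] at h
  refine tendsto_of_tendsto_of_tendsto_of_le_of_le tendsto_const_nhds h (fun _ => zero_le) ?_
  intro k
  have e : (fun x => f k x - g k x) = (fun x => f k x - u x) - fun x => g k x - u x := by
    funext x
    simp
  beta_reduce
  rw [e]
  exact eLpNorm_sub_le ((hf k).sub hu) ((hg k).sub hu) (by norm_num)

lemma gradient_sub {φ ψ : Plane → ℝ} (hφ : ContDiff ℝ 1 φ) (hψ : ContDiff ℝ 1 ψ) (x : Plane) :
    gradient (fun y => φ y - ψ y) x = gradient φ x - gradient ψ x := by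
  refine ext_inner_right ℝ fun e => ?_
  rw [inner_sub_left, inner_gradient, inner_gradient, inner_gradient,
    fderiv_fun_sub (hφ.differentiable one_ne_zero x) (hψ.differentiable one_ne_zero x)]
  rfl

/-- The trace inequality is applied to `φ k - ψ k`, which tends to zero together with its gradient.
The index type is arbitrary: `ℕ` serves uniqueness of traces, and `ℕ × ℕ` the Cauchy property behind
their existence. -/
lemma tendsto_eLpNorm_bdry_disk {ι : Type*} {l : Filter ι} {φ ψ : ι → Plane → ℝ} {u : Plane → ℝ}
    (hu : MemH1 disk u) (hφ : ∀ k, ContDiff ℝ 1 (φ k)) (hψ : ∀ k, ContDiff ℝ 1 (ψ k))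
    (h1 : Tendsto (fun k => eLpNorm (fun x => φ k x - u x) 2 (volume.restrict disk)) l (𝓝 0))
    (h2 : Tendsto (fun k => eLpNorm (fun x => gradient (φ k) x - weakGrad disk u x) 2
      (volume.restrict disk)) l (𝓝 0))
    (h3 : Tendsto (fun k => eLpNorm (fun x => ψ k x - u x) 2 (volume.restrict disk)) l (𝓝 0))
    (h4 : Tendsto (fun k => eLpNorm (fun x => gradient (ψ k) x - weakGrad disk u x) 2
      (volume.restrict disk)) l (𝓝 0)) :
    Tendsto (fun k => eLpNorm (fun x => φ k x - ψ k x) 2 (bdry disk)) l (𝓝 0) := by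
  have t1 := tendsto_eLpNorm_sub_sub (fun k => (hφ k).continuous.aestronglyMeasurable)
    (fun k => (hψ k).continuous.aestronglyMeasurable) hu.1.1 h1 h3
  have t2 := tendsto_eLpNorm_sub_sub
    (fun k => (continuous_gradient (hφ k)).aestronglyMeasurable)
    (fun k => (continuous_gradient (hψ k)).aestronglyMeasurable)
    (hu.memLp_weakGrad Metric.isOpen_ball).1 h2 h4
  refine tendsto_zero_of_sq_tendsto_zero ?_
  have t3 : Tendsto (fun k => 3 * eLpNorm (fun x => φ k x - ψ k x) 2 (volume.restrict disk) ^ 2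
      + eLpNorm (fun x => gradient (φ k) x - gradient (ψ k) x) 2 (volume.restrict disk) ^ 2)
      l (𝓝 0) := by
    have := (ENNReal.Tendsto.const_mul (a := 3) (ENNReal.Tendsto.pow (n := 2) t1)
      (Or.inr (by norm_num))).add (ENNReal.Tendsto.pow (n := 2) t2)
    simpa using this
  refine tendsto_of_tendsto_of_tendsto_of_le_of_le tendsto_const_nhds t3 (fun _ => zero_le) ?_
  intro k
  have := eLpNorm_bdry_disk_sq_le ((hφ k).sub (hψ k))
  have e : gradient (fun x => φ k x - ψ k x) = fun x => gradient (φ k) x - gradient (ψ k) x :=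
    funext fun x => gradient_sub (hφ k) (hψ k) x
  beta_reduce
  rw [← e]
  exact this

lemma eLpNorm_sub_le_add_add {α E : Type*} [MeasurableSpace α] [NormedAddCommGroup E]
    {μ : Measure α} {g h φ ψ : α → E} (hg : AEStronglyMeasurable g μ)
    (hh : AEStronglyMeasurable h μ) (hφ : AEStronglyMeasurable φ μ)
    (hψ : AEStronglyMeasurable ψ μ) :
    eLpNorm (fun x => g x - h x) 2 μ ≤ eLpNorm (fun x => φ x - g x) 2 μ
      + (eLpNorm (fun x => φ x - ψ x) 2 μ + eLpNorm (fun x => ψ x - h x) 2 μ) := by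
  have e : (fun x => g x - h x)
      = (fun x => g x - φ x) + ((fun x => φ x - ψ x) + fun x => ψ x - h x) := by
    funext x
    simp
  have e' : eLpNorm (fun x => g x - φ x) 2 μ = eLpNorm (fun x => φ x - g x) 2 μ := by
    rw [← eLpNorm_neg]
    congr 1
    funext x
    simp
  rw [e, ← e']
  refine (eLpNorm_add_le (hg.sub hφ) ((hφ.sub hψ).add (hψ.sub hh)) (by norm_num)).trans ?_
  exact add_le_add le_rfl (eLpNorm_add_le (hφ.sub hψ) (hψ.sub hh) (by norm_num))

lemma isTrace_disk_unique {u g h : Plane → ℝ} (hu : MemH1 disk u) (hg : IsTrace disk u g)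
    (hh : IsTrace disk u h) : g =ᵐ[bdry disk] h := by
  obtain ⟨hg2, φ, hφ, p1, p2, p3⟩ := hg
  obtain ⟨hh2, ψ, hψ, q1, q2, q3⟩ := hh
  have t := tendsto_eLpNorm_bdry_disk hu hφ hψ p1 p2 q1 q2
  have t' := p3.add (t.add q3)
  rw [add_zero, add_zero] at t'
  have h0 : eLpNorm (fun x => g x - h x) 2 (bdry disk) ≤ 0 :=
    ge_of_tendsto' t' fun k => eLpNorm_sub_le_add_add hg2.1 hh2.1
      (hφ k).continuous.aestronglyMeasurable (hψ k).continuous.aestronglyMeasurable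
  have h1 := (eLpNorm_eq_zero_iff (hg2.1.sub hh2.1) (by norm_num)).1 (le_antisymm h0 zero_le)
  filter_upwards [h1] with x hx
  exact sub_eq_zero.1 hx

/-- Plain mollification gives the right gradient only away from the circle. Evaluating the
mollification at the contracted point `r k • x` moves the whole mollifying ball inside the disk for
every `x` in the disk. -/
lemma exists_contDiff_tendsto_disk {u : Plane → ℝ} (hu : MemH1 disk u) :
    ∃ φ : ℕ → Plane → ℝ, (∀ k, ContDiff ℝ 1 (φ k)) ∧
      Tendsto (fun k => eLpNorm (fun x => φ k x - u x) 2 (volume.restrict disk)) atTop (𝓝 0) ∧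
      Tendsto (fun k => eLpNorm (fun x => gradient (φ k) x - weakGrad disk u x) 2
        (volume.restrict disk)) atTop (𝓝 0) := by
  have hdm : MeasurableSet disk := measurableSet_ball
  set g := weakGrad disk u
  have hg : MemLp g 2 (volume.restrict disk) := hu.memLp_weakGrad Metric.isOpen_ball
  have hUl : LocallyIntegrable (disk.indicator u) :=
    (memLp_indicator_of_restrict hdm hu.1).locallyIntegrable (by norm_num)
  have hGl : LocallyIntegrable (disk.indicator g) :=
    (memLp_indicator_of_restrict hdm hg).locallyIntegrable (by norm_num)
  -- With this choice `r k * ‖x‖ + rOut < 1` whenever `‖x‖ < 1` and `r k > 0`.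
  set r : ℕ → ℝ := fun k => 1 - (bumpSeq k).rOut
  have hr : Tendsto r atTop (𝓝 1) := by
    have := tendsto_bumpSeq_rOut.const_sub 1
    rwa [sub_zero] at this
  set V : ℕ → Plane → ℝ := fun k => mollify (bumpSeq k) (disk.indicator u)
  set W : ℕ → Plane → Plane := fun k => mollify (bumpSeq k) (disk.indicator g)
  have hV : ∀ k, ContDiff ℝ 1 (V k) := fun k => contDiff_mollify (n := 1) _ hUl
  have hW : ∀ k, ContDiff ℝ 1 (W k) := fun k => contDiff_mollify (n := 1) _ hGl
  refine ⟨fun k x => V k (r k • x), fun k => (hV k).comp (contDiff_const_smul _),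
    tendsto_eLpNorm_mollify_indicator hdm Metric.isBounded_ball hu.1 hr, ?_⟩
  have t1 := tendsto_eLpNorm_mollify_indicator hdm Metric.isBounded_ball hg hr
  have hrn : Tendsto (fun k => ‖r k‖ₑ) atTop (𝓝 1) := by
    have := hr.enorm
    simpa using this
  have hrn1 : Tendsto (fun k => ‖r k - 1‖ₑ) atTop (𝓝 0) := by
    have := (hr.sub_const 1).enorm
    simpa using this
  have t2 : Tendsto (fun k => ‖r k‖ₑ * eLpNorm (fun x => W k (r k • x) - g x) 2
      (volume.restrict disk) + ‖r k - 1‖ₑ * eLpNorm g 2 (volume.restrict disk)) atTop (𝓝 0) := by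
    have := (ENNReal.Tendsto.mul hrn (Or.inl one_ne_zero) t1 (Or.inr ENNReal.one_ne_top)).add
      (ENNReal.Tendsto.mul_const hrn1 (Or.inr hg.eLpNorm_ne_top))
    simpa using this
  refine tendsto_of_tendsto_of_tendsto_of_le_of_le' tendsto_const_nhds t2
    (Eventually.of_forall fun _ => zero_le) ?_
  -- At `k = 0` the mollification radius is `1` and the contraction factor is `0`, so this index is
  -- discarded.
  filter_upwards [eventually_ge_atTop 1] with k hk
  have hrpos : 0 < r k := by
    have : (1 : ℝ) ≤ k := by exact_mod_cast hk
    have h2 : (bumpSeq k).rOut < 1 := by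
      change 1 / ((k : ℝ) + 1) < 1
      rw [div_lt_one (by positivity)]
      linarith
    simp only [r]
    linarith
  have hgrad : ∀ x ∈ disk, gradient (fun x => V k (r k • x)) x - g x
      = r k • (W k (r k • x) - g x) + (r k - 1) • g x := by
    intro x hx
    have hx1 : ‖x‖ < 1 := by simpa using hx
    have hball : Metric.closedBall (r k • x) (bumpSeq k).rOut ⊆ disk := by
      intro y hy
      rw [Metric.mem_closedBall, dist_eq_norm] at hy
      rw [Metric.mem_ball, dist_zero_right]
      calc ‖y‖ = ‖r k • x + (y - r k • x)‖ := by rw [add_sub_cancel]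
        _ ≤ ‖r k • x‖ + ‖y - r k • x‖ := norm_add_le _ _
        _ ≤ r k * ‖x‖ + (bumpSeq k).rOut := by
          rw [norm_smul, Real.norm_of_nonneg hrpos.le]
          linarith
        _ < r k * 1 + (bumpSeq k).rOut := by
          have := mul_lt_mul_of_pos_left hx1 hrpos
          linarith
        _ = 1 := by simp [r]
    have h1 : gradient (fun x => V k (r k • x)) x = r k • W k (r k • x) := by
      refine ext_inner_right ℝ fun e => ?_
      rw [inner_gradient, real_inner_smul_left,
        ← hu.isWeakGrad.fderiv_mollify_indicator hdm hUl hGl (bumpSeq k) hball]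
      have h2 : HasFDerivAt (fun x : Plane => r k • x) (r k • ContinuousLinearMap.id ℝ Plane) x :=
        (hasFDerivAt_id x).const_smul (r k)
      have h3 : HasFDerivAt (fun x => V k (r k • x)) _ x :=
        ((hV k).differentiable one_ne_zero (r k • x)).hasFDerivAt.comp x h2
      rw [h3.fderiv]
      simp [V]
    rw [h1]
    generalize r k = c
    module
  have m1 : AEStronglyMeasurable (fun x => W k (r k • x) - g x) (volume.restrict disk) :=
    (((hW k).continuous.comp (continuous_const_smul _)).aestronglyMeasurable).sub hg.1
  calc eLpNorm (fun x => gradient (fun x => V k (r k • x)) x - g x) 2 (volume.restrict disk)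
      = eLpNorm ((r k • fun x => W k (r k • x) - g x) + (r k - 1) • g) 2
          (volume.restrict disk) :=
        eLpNorm_congr_ae ((ae_restrict_mem hdm).mono hgrad)
    _ ≤ _ := by
        refine (eLpNorm_add_le (m1.const_smul _) (hg.1.const_smul _) (by norm_num)).trans ?_
        rw [eLpNorm_const_smul, eLpNorm_const_smul]

/-- The boundary values of a `C¹` approximating sequence form a Cauchy sequence in `L²` of the
circle by the trace inequality; completeness supplies the trace. -/
lemma exists_isTrace_disk {u : Plane → ℝ} (hu : MemH1 disk u) : ∃ g, IsTrace disk u g := by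
  obtain ⟨φ, hφ, h1, h2⟩ := exists_contDiff_tendsto_disk hu
  have hm : ∀ k, MemLp (φ k) 2 (bdry disk) := fun k =>
    memLp_bdry_disk_of_continuous (hφ k).continuous
  have f1 : Tendsto (fun p : ℕ × ℕ => p.1) atTop atTop := by
    rw [← prod_atTop_atTop_eq]; exact tendsto_fst
  have f2 : Tendsto (fun p : ℕ × ℕ => p.2) atTop atTop := by
    rw [← prod_atTop_atTop_eq]; exact tendsto_snd
  have t := tendsto_eLpNorm_bdry_disk (l := (atTop : Filter (ℕ × ℕ))) hu (fun p => hφ p.1)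
    (fun p => hφ p.2) (h1.comp f1) (h2.comp f1) (h1.comp f2) (h2.comp f2)
  have hC : CauchySeq fun k => (hm k).toLp (φ k) := by
    rw [cauchySeq_iff_tendsto_dist_atTop_0]
    have := (ENNReal.tendsto_toReal ENNReal.zero_ne_top).comp t
    refine this.congr fun p => ?_
    rw [dist_edist, Lp.edist_toLp_toLp]
    rfl
  obtain ⟨g, hg⟩ := cauchySeq_tendsto_of_complete hC
  have hgm := Lp.memLp g
  refine ⟨g, hgm, φ, hφ, h1, h2, ?_⟩
  rw [← Lp.toLp_coeFn g hgm] at hg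
  exact (Lp.tendsto_Lp_iff_tendsto_eLpNorm'' φ hm g hgm).1 hg

end DiskTrace

section TraceTransformation

open scoped ENNReal

/-! ### Transformation of traces -/

lemma gradient_comp_eq_pullbackGrad {T : Plane → Plane} (hT : ContDiff ℝ 1 T) {φ : Plane → ℝ}
    (hφ : ContDiff ℝ 1 φ) (x : Plane) :
    gradient (φ ∘ T) x = pullbackGrad T (gradient φ) x := by
  refine ext_inner_right ℝ fun e => ?_
  rw [inner_gradient, pullbackGrad, ContinuousLinearMap.adjoint_inner_left, inner_gradient,
    fderiv_comp x (hφ.differentiable one_ne_zero _) (hT.differentiable one_ne_zero _)]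
  rfl

/-- Approximants that are `C¹` stay `C¹` under composition with `T`. Bounds on `DT` preserve
convergence of gradients, and the comparison `hle` of boundary measures preserves convergence on the
boundary. -/
lemma IsVolumeDiffeo.isTrace_comp {T : Plane ≃ Plane} (hT : IsVolumeDiffeo T) {Ω : Set Plane}
    (hΩ : IsOpen Ω) (hb : Bornology.IsBounded Ω) {u g : Plane → ℝ} (hu : MemH1 Ω u)
    {C : ℝ≥0∞} (hC : C ≠ ⊤) (hle : (bdry (T ⁻¹' Ω)).map T ≤ C • bdry Ω) (hg : IsTrace Ω u g) :
    IsTrace (T ⁻¹' Ω) (u ∘ T) (g ∘ T) := by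
  obtain ⟨hg2, φ, hφ, p1, p2, p3⟩ := hg
  have hTm : Measurable T := hT.contDiff.continuous.measurable
  have hmp := hT.restrict_preimage Ω
  have hgm : MemLp g 2 ((bdry (T ⁻¹' Ω)).map T) := hg2.of_measure_le_smul hC hle
  refine ⟨(memLp_map_measure_iff hgm.1 hTm.aemeasurable).1 hgm, fun k => φ k ∘ T,
    fun k => (hφ k).comp hT.contDiff, ?_, ?_, ?_⟩
  · refine p1.congr fun k => ?_
    exact (eLpNorm_comp_measurePreserving
      (((hφ k).continuous.aestronglyMeasurable).sub hu.1.1) hmp).symm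
  · obtain ⟨M, -, hM⟩ := hT.exists_norm_fderiv_le (hT.isBounded_preimage hb)
    have t : Tendsto (fun k => ENNReal.ofReal M *
        eLpNorm (fun x => gradient (φ k) x - weakGrad Ω u x) 2 (volume.restrict Ω))
        atTop (𝓝 0) := by
      have := ENNReal.Tendsto.const_mul (a := ENNReal.ofReal M) p2 (Or.inr ENNReal.ofReal_ne_top)
      rwa [mul_zero] at this
    refine tendsto_of_tendsto_of_tendsto_of_le_of_le tendsto_const_nhds t (fun _ => zero_le) ?_
    intro k
    beta_reduce
    rw [← eLpNorm_comp_measurePreserving (g := fun x => gradient (φ k) x - weakGrad Ω u x)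
      (((continuous_gradient (hφ k)).aestronglyMeasurable).sub
      (hu.memLp_weakGrad hΩ).1) hmp]
    refine eLpNorm_le_mul_eLpNorm_of_ae_le_mul ?_ 2
    filter_upwards [hT.weakGrad_comp hΩ hb hu,
      ae_restrict_mem (hTm hΩ.measurableSet)] with x hx hxΩ
    have := norm_pullbackGrad_le (g := fun x => gradient (φ k) x - weakGrad Ω u x) (hM x hxΩ)
    rw [hx, gradient_comp_eq_pullbackGrad hT.contDiff (hφ k)]
    simp only [pullbackGrad, map_sub] at this ⊢
    exact this
  · have t : Tendsto (fun k => C ^ (1 / (2 : ℝ≥0∞)).toReal *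
        eLpNorm (fun x => φ k x - g x) 2 (bdry Ω)) atTop (𝓝 0) := by
      have := ENNReal.Tendsto.const_mul (a := C ^ (1 / (2 : ℝ≥0∞)).toReal) p3
        (Or.inr (ENNReal.rpow_ne_top_of_nonneg ENNReal.toReal_nonneg hC))
      rwa [mul_zero] at this
    refine tendsto_of_tendsto_of_tendsto_of_le_of_le tendsto_const_nhds t (fun _ => zero_le) ?_
    intro k
    calc eLpNorm ((fun x => φ k x - g x) ∘ T) 2 (bdry (T ⁻¹' Ω))
        = eLpNorm (fun x => φ k x - g x) 2 ((bdry (T ⁻¹' Ω)).map T) :=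
          hT.measurableEmbedding.eLpNorm_map_measure.symm
      _ ≤ eLpNorm (fun x => φ k x - g x) 2 (C • bdry Ω) := eLpNorm_mono_measure _ hle
      _ ≤ _ := eLpNorm_smul_measure_le _ _ _ _

lemma preimage_image_disk (T : Plane ≃ Plane) : T ⁻¹' (T '' disk) = disk :=
  preimage_image_eq _ T.injective

lemma symm_preimage_disk (T : Plane ≃ Plane) : T.symm ⁻¹' disk = T '' disk :=
  (Equiv.image_eq_preimage_symm T disk).symm

/-! ### Two-sided comparison of arc length on the circle and on its image. -/

section BoundaryMeasure

variable {T : Plane ≃ Plane}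

lemma IsVolumeDiffeo.continuous_tangent (hT : IsVolumeDiffeo T) :
    Continuous fun x : Plane => fderiv ℝ T x (rot x) :=
  (hT.contDiff.continuous_fderiv one_ne_zero).clm_apply continuous_rot

lemma IsVolumeDiffeo.norm_le_mul_norm_fderiv (hT : IsVolumeDiffeo T) (x v : Plane) :
    ‖v‖ ≤ ‖fderiv ℝ T.symm (T x)‖ * ‖fderiv ℝ T x v‖ := by
  have h1 : HasFDerivAt (T.symm ∘ T) ((fderiv ℝ T.symm (T x)).comp (fderiv ℝ T x)) x :=
    (hT.contDiff_symm.differentiable one_ne_zero _).hasFDerivAt.comp x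
      (hT.contDiff.differentiable one_ne_zero _).hasFDerivAt
  rw [Equiv.symm_comp_self] at h1
  have h2 := h1.unique (hasFDerivAt_id x)
  have h3 : fderiv ℝ T.symm (T x) (fderiv ℝ T x v) = v := by
    have := congrArg (fun L : Plane →L[ℝ] Plane => L v) h2
    simpa using this
  calc ‖v‖ = ‖fderiv ℝ T.symm (T x) (fderiv ℝ T x v)‖ := by rw [h3]
    _ ≤ _ := ContinuousLinearMap.le_opNorm _ _

/-- The density of arc length is bounded below: `DT` is inverted by the derivative of `T.symm`,
whose norm is at most `M` along the image of the circle, so unit tangents keep length at least `1 /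
M`. -/
lemma IsVolumeDiffeo.map_bdry_disk_le (hT : IsVolumeDiffeo T) :
    ∃ C : ℝ≥0∞, C ≠ ⊤ ∧ (bdry disk).map T ≤ C • bdry (T '' disk) := by
  have hc : Continuous fun x => fderiv ℝ T.symm (T x) :=
    (hT.contDiff_symm.continuous_fderiv one_ne_zero).comp hT.contDiff.continuous
  obtain ⟨M, hM⟩ := (isCompact_sphere (0 : Plane) 1).exists_bound_of_continuousOn hc.continuousOn
  refine ⟨ENNReal.ofReal M, ENNReal.ofReal_ne_top, ?_⟩
  rw [hT.bdry_image, ← Measure.map_smul]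
  refine Measure.map_mono ?_ hT.contDiff.continuous.measurable
  refine Measure.le_iff.2 fun S hS => ?_
  rw [Measure.smul_apply, withDensity_apply _ hS, smul_eq_mul,
    ← lintegral_const_mul _ hT.continuous_tangent.enorm.measurable, ← setLIntegral_one]
  refine lintegral_mono_ae (ae_restrict_of_ae (ae_bdry_disk_mem_sphere.mono fun x hx => ?_))
  have hx1 : ‖rot x‖ = 1 := by
    rw [norm_rot]
    simpa using hx
  have h1 : 1 ≤ M * ‖fderiv ℝ T x (rot x)‖ := by
    rw [← hx1]
    refine (hT.norm_le_mul_norm_fderiv x (rot x)).trans ?_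
    gcongr
    exact hM x hx
  have hM0 : 0 ≤ M := (norm_nonneg _).trans (hM x hx)
  rw [← ofReal_norm, ← ENNReal.ofReal_mul hM0, ← ENNReal.ofReal_one]
  exact ENNReal.ofReal_le_ofReal h1

lemma IsVolumeDiffeo.map_symm_bdry_image_le (hT : IsVolumeDiffeo T) :
    ∃ C : ℝ≥0∞, C ≠ ⊤ ∧ (bdry (T '' disk)).map T.symm ≤ C • bdry disk := by
  obtain ⟨M, hM⟩ := (isCompact_sphere (0 : Plane) 1).exists_bound_of_continuousOn
    hT.continuous_tangent.continuousOn
  refine ⟨ENNReal.ofReal M, ENNReal.ofReal_ne_top, ?_⟩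
  rw [hT.bdry_image, Measure.map_map hT.contDiff_symm.continuous.measurable
    hT.contDiff.continuous.measurable, Equiv.symm_comp_self, Measure.map_id]
  refine Measure.le_iff.2 fun S hS => ?_
  rw [Measure.smul_apply, withDensity_apply _ hS, smul_eq_mul, ← setLIntegral_const]
  refine lintegral_mono_ae (ae_restrict_of_ae (ae_bdry_disk_mem_sphere.mono fun x hx => ?_))
  rw [← ofReal_norm]
  exact ENNReal.ofReal_le_ofReal (hM x hx)

lemma IsVolumeDiffeo.isTrace_comp_disk (hT : IsVolumeDiffeo T) {u g : Plane → ℝ}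
    (hΩ : IsOpen (T '' disk)) (hb : Bornology.IsBounded (T '' disk))
    (hu : MemH1 (T '' disk) u) (hg : IsTrace (T '' disk) u g) : IsTrace disk (u ∘ T) (g ∘ T) := by
  obtain ⟨C, hC, hle⟩ := hT.map_bdry_disk_le
  have h := hT.isTrace_comp hΩ hb hu hC (g := g)
  rw [preimage_image_disk] at h
  exact h hle hg

lemma IsVolumeDiffeo.isTrace_comp_symm (hT : IsVolumeDiffeo T) {v g : Plane → ℝ}
    (hv : MemH1 disk v) (hg : IsTrace disk v g) :
    IsTrace (T '' disk) (v ∘ T.symm) (g ∘ T.symm) := by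
  obtain ⟨C, hC, hle⟩ := hT.map_symm_bdry_image_le
  have h := hT.symm.isTrace_comp Metric.isOpen_ball Metric.isBounded_ball hv hC (g := g)
  rw [symm_preimage_disk] at h
  exact h hle hg

end BoundaryMeasure

/-! ### Domains with a trace operator -/

/-- A bounded open set on which every `H¹` function has a trace, unique up to null sets. -/
structure IsTraceDomain (Ω : Set Plane) : Prop where
  isOpen : IsOpen Ω
  isBounded : Bornology.IsBounded Ω
  exists_trace : ∀ u, MemH1 Ω u → ∃ g, IsTrace Ω u g
  unique : ∀ u g h, MemH1 Ω u → IsTrace Ω u g → IsTrace Ω u h → g =ᵐ[bdry Ω] h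

lemma isTraceDomain_disk : IsTraceDomain disk where
  isOpen := Metric.isOpen_ball
  isBounded := Metric.isBounded_ball
  exists_trace _ hu := exists_isTrace_disk hu
  unique _ _ _ hu hg hh := isTrace_disk_unique hu hg hh

lemma IsVolumeDiffeo.memH1_comp_symm {T : Plane ≃ Plane} (hT : IsVolumeDiffeo T) {v : Plane → ℝ}
    (hv : MemH1 disk v) : MemH1 (T '' disk) (v ∘ T.symm) := by
  have := hT.symm.memH1_comp Metric.isOpen_ball Metric.isBounded_ball hv
  rwa [symm_preimage_disk] at this

/-- Existence and uniqueness of traces are imported from the disk by composing with `T` and its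
inverse; no boundary chart of `Ω` is used. -/
lemma IsVolumeDiffeo.isTraceDomain_image {T : Plane ≃ Plane} (hT : IsVolumeDiffeo T) :
    IsTraceDomain (T '' disk) := by
  have hΩ : IsOpen (T '' disk) := by
    rw [← symm_preimage_disk]
    exact Metric.isOpen_ball.preimage hT.contDiff_symm.continuous
  have hb : Bornology.IsBounded (T '' disk) := by
    rw [← symm_preimage_disk]
    exact hT.symm.isBounded_preimage Metric.isBounded_ball
  have hcomp : ∀ u, MemH1 (T '' disk) u → MemH1 disk (u ∘ T) := fun u hu => by
    have := hT.memH1_comp hΩ hb hu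
    rwa [preimage_image_disk] at this
  refine ⟨hΩ, hb, fun u hu => ?_, fun u g h hu hg hh => ?_⟩
  · obtain ⟨g, hg⟩ := exists_isTrace_disk (hcomp u hu)
    have := hT.isTrace_comp_symm (hcomp u hu) hg
    refine ⟨g ∘ T.symm, ?_⟩
    convert this using 1
    funext x
    simp
  · have h1 := isTrace_disk_unique (hcomp u hu) (hT.isTrace_comp_disk hΩ hb hu hg)
      (hT.isTrace_comp_disk hΩ hb hu hh)
    rw [hT.bdry_image, EventuallyEq, hT.measurableEmbedding.ae_map_iff]
    exact (withDensity_absolutelyContinuous _ _).ae_le h1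

lemma IsVolumeDiffeo.memH1_comp_disk {T : Plane ≃ Plane} (hT : IsVolumeDiffeo T) {u : Plane → ℝ}
    (hu : MemH1 (T '' disk) u) : MemH1 disk (u ∘ T) := by
  have := hT.memH1_comp hT.isTraceDomain_image.isOpen hT.isTraceDomain_image.isBounded hu
  rwa [preimage_image_disk] at this

lemma IsVolumeDiffeo.weakGrad_comp_disk {T : Plane ≃ Plane} (hT : IsVolumeDiffeo T)
    {u : Plane → ℝ} (hu : MemH1 (T '' disk) u) :
    weakGrad disk (u ∘ T) =ᵐ[volume.restrict disk] pullbackGrad T (weakGrad (T '' disk) u) := by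
  have := hT.weakGrad_comp hT.isTraceDomain_image.isOpen hT.isTraceDomain_image.isBounded hu
  rwa [preimage_image_disk] at this

namespace IsTraceDomain

variable {Ω : Set Plane}

lemma isTrace_trace (hΩ : IsTraceDomain Ω) {u : Plane → ℝ} (hu : MemH1 Ω u) :
    IsTrace Ω u (trace Ω u) := by
  have h := hΩ.exists_trace u hu
  rw [trace, dif_pos h]
  exact h.choose_spec

/-- Sums of approximating sequences exhibit the sum of the traces as a trace, and uniqueness does
the rest. -/
lemma trace_add (hΩ : IsTraceDomain Ω) {u v : Plane → ℝ} (hu : MemH1 Ω u) (hv : MemH1 Ω v) :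
    trace Ω (fun x => u x + v x) =ᵐ[bdry Ω] fun x => trace Ω u x + trace Ω v x := by
  refine hΩ.unique _ _ _ (hu.add hv) (hΩ.isTrace_trace (hu.add hv)) ?_
  obtain ⟨hg2, φ, hφ, p1, p2, p3⟩ := hΩ.isTrace_trace hu
  obtain ⟨hh2, ψ, hψ, q1, q2, q3⟩ := hΩ.isTrace_trace hv
  have mφ : ∀ k (μ : Measure Plane), AEStronglyMeasurable (φ k) μ := fun k μ =>
    (hφ k).continuous.aestronglyMeasurable
  have mψ : ∀ k (μ : Measure Plane), AEStronglyMeasurable (ψ k) μ := fun k μ =>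
    (hψ k).continuous.aestronglyMeasurable
  have key : ∀ {E : Type} [NormedAddCommGroup E] (μ : Measure Plane) (a b c d : Plane → E),
      AEStronglyMeasurable a μ → AEStronglyMeasurable b μ → AEStronglyMeasurable c μ →
      AEStronglyMeasurable d μ → eLpNorm (fun x => a x + b x - (c x + d x)) 2 μ
        ≤ eLpNorm (fun x => a x - c x) 2 μ + eLpNorm (fun x => b x - d x) 2 μ := by
    intro E _ μ a b c d ha hb hc hd
    have e : (fun x => a x + b x - (c x + d x)) = (fun x => a x - c x) + fun x => b x - d x := by
      funext x
      simp only [Pi.add_apply]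
      abel
    rw [e]
    exact eLpNorm_add_le (ha.sub hc) (hb.sub hd) (by norm_num)
  have sq : ∀ {a b c : ℕ → ℝ≥0∞}, Tendsto a atTop (𝓝 0) → Tendsto b atTop (𝓝 0) →
      (∀ k, c k ≤ a k + b k) → Tendsto c atTop (𝓝 0) := fun ha hb hc => by
    have := ha.add hb
    rw [add_zero] at this
    exact tendsto_of_tendsto_of_tendsto_of_le_of_le tendsto_const_nhds this (fun _ => zero_le) hc
  refine ⟨hg2.add hh2, fun k x => φ k x + ψ k x, fun k => (hφ k).add (hψ k), ?_, ?_, ?_⟩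
  · exact sq p1 q1 fun k => key _ _ _ _ _ (mφ k _) (mψ k _) hu.1.1 hv.1.1
  · refine sq p2 q2 fun k => ?_
    have e : (fun x => gradient (fun x => φ k x + ψ k x) x - weakGrad Ω (fun x => u x + v x) x)
        =ᵐ[volume.restrict Ω] fun x => gradient (φ k) x + gradient (ψ k) x
          - (weakGrad Ω u x + weakGrad Ω v x) := by
      filter_upwards [hu.weakGrad_add hΩ.isOpen hv] with x hx
      rw [hx]
      congr 1
      refine ext_inner_right ℝ fun e => ?_
      rw [inner_add_left, inner_gradient, inner_gradient, inner_gradient,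
        fderiv_fun_add ((hφ k).differentiable one_ne_zero x)
          ((hψ k).differentiable one_ne_zero x)]
      rfl
    rw [eLpNorm_congr_ae e]
    exact key _ _ _ _ _ (continuous_gradient (hφ k)).aestronglyMeasurable
      (continuous_gradient (hψ k)).aestronglyMeasurable (hu.memLp_weakGrad hΩ.isOpen).1
      (hv.memLp_weakGrad hΩ.isOpen).1
  · exact sq p3 q3 fun k => key _ _ _ _ _ (mφ k _) (mψ k _) hg2.1 hh2.1

end IsTraceDomain

lemma IsVolumeDiffeo.trace_comp_disk {T : Plane ≃ Plane} (hT : IsVolumeDiffeo T)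
    {u : Plane → ℝ} (hu : MemH1 (T '' disk) u) :
    trace disk (u ∘ T) =ᵐ[bdry disk] trace (T '' disk) u ∘ T :=
  isTrace_disk_unique (hT.memH1_comp_disk hu)
    (isTraceDomain_disk.isTrace_trace (hT.memH1_comp_disk hu))
    (hT.isTrace_comp_disk hT.isTraceDomain_image.isOpen hT.isTraceDomain_image.isBounded hu
      (hT.isTraceDomain_image.isTrace_trace hu))

/-- An `H¹` function on the disk with zero gradient and zero trace vanishes. -/
lemma ae_eq_zero_of_weakGrad_of_trace {v : Plane → ℝ} (hv : MemH1 disk v)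
    (hg : weakGrad disk v =ᵐ[volume.restrict disk] 0) (ht : trace disk v =ᵐ[bdry disk] 0) :
    v =ᵐ[volume.restrict disk] 0 := by
  obtain ⟨-, φ, hφ, p1, p2, p3⟩ := isTraceDomain_disk.isTrace_trace hv
  have q2 : Tendsto (fun k => eLpNorm (gradient (φ k)) 2 (volume.restrict disk)) atTop (𝓝 0) := by
    refine p2.congr fun k => eLpNorm_congr_ae ?_
    filter_upwards [hg] with x hx
    simp [hx]
  have q3 : Tendsto (fun k => eLpNorm (φ k) 2 (bdry disk)) atTop (𝓝 0) := by
    refine p3.congr fun k => eLpNorm_congr_ae ?_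
    filter_upwards [ht] with x hx
    simp [hx]
  have q1 : Tendsto (fun k => eLpNorm (φ k) 2 (volume.restrict disk)) atTop (𝓝 0) := by
    refine tendsto_zero_of_sq_tendsto_zero ?_
    have := (ENNReal.Tendsto.pow (n := 2) q3).add (ENNReal.Tendsto.pow (n := 2) q2)
    rw [zero_pow two_ne_zero, add_zero] at this
    exact tendsto_of_tendsto_of_tendsto_of_le_of_le tendsto_const_nhds this (fun _ => zero_le)
      fun k => eLpNorm_disk_sq_le (hφ k)
  have t := q1.add p1
  rw [add_zero] at t
  have h0 : eLpNorm v 2 (volume.restrict disk) ≤ 0 := by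
    refine ge_of_tendsto' t fun k => ?_
    have mφ : AEStronglyMeasurable (φ k) (volume.restrict disk) :=
      (hφ k).continuous.aestronglyMeasurable
    have e : v = φ k - fun x => φ k x - v x := by
      funext x
      simp
    calc eLpNorm v 2 (volume.restrict disk)
        = eLpNorm (φ k - fun x => φ k x - v x) 2 (volume.restrict disk) := by rw [← e]
      _ ≤ _ := eLpNorm_sub_le mφ (mφ.sub hv.1.1) (by norm_num)
  exact (eLpNorm_eq_zero_iff hv.1.1 (by norm_num)).1 (le_antisymm h0 zero_le)

end TraceTransformation

section Forms

open scoped ENNReal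

/-! ### Symplectic maps -/

lemma toEuclideanLin_jac (T : Plane → Plane) (x : Plane) :
    Matrix.toEuclideanLin (jac T x) = (fderiv ℝ T x : Plane →ₗ[ℝ] Plane) := by
  refine (EuclideanSpace.basisFun (Fin 2) ℝ).toBasis.ext fun j => ?_
  ext i
  fin_cases j <;> simp [jac, Matrix.toLpLin_apply]

lemma fderiv_apply_eq (T : Plane → Plane) (x v : Plane) (i : Fin 2) :
    (fderiv ℝ T x v) i = jac T x i 0 * v 0 + jac T x i 1 * v 1 := by
  have h := congrArg (fun L : Plane →ₗ[ℝ] Plane => L v i) (toEuclideanLin_jac T x)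
  fin_cases i <;> simpa [Matrix.toLpLin_apply, Matrix.mulVec, dotProduct] using h.symm

lemma adjoint_fderiv_apply_eq (T : Plane → Plane) (x p : Plane) (i : Fin 2) :
    (ContinuousLinearMap.adjoint (fderiv ℝ T x) p) i = jac T x 0 i * p 0 + jac T x 1 i * p 1 := by
  have h : (ContinuousLinearMap.adjoint (fderiv ℝ T x) p) i
      = inner ℝ (ContinuousLinearMap.adjoint (fderiv ℝ T x) p) (EuclideanSpace.single i 1) := by
    fin_cases i <;> simp [PiLp.inner_apply]
  rw [h, ContinuousLinearMap.adjoint_inner_left]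
  simp [PiLp.inner_apply, Fin.sum_univ_two, jac]

lemma IsSymplecticMap.det_jac {T : Plane ≃ Plane} (hT : IsSymplecticMap T) (x : Plane) :
    jac T x 0 0 * jac T x 1 1 - jac T x 0 1 * jac T x 1 0 = 1 := by
  have h := congrFun (congrFun (hT.symplectic x) 0) 1
  simp [Matrix.mul_apply, Fin.sum_univ_two] at h
  linarith

lemma IsSymplecticMap.det_fderiv {T : Plane ≃ Plane} (hT : IsSymplecticMap T) (x : Plane) :
    (fderiv ℝ T x).det = 1 := by
  rw [ContinuousLinearMap.det, ← toEuclideanLin_jac, Matrix.toEuclideanLin_eq_toLin_orthonormal,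
    LinearMap.det_toLin, Matrix.det_fin_two]
  exact hT.det_jac x

lemma IsSymplecticMap.isVolumeDiffeo {T : Plane ≃ Plane} (hT : IsSymplecticMap T) :
    IsVolumeDiffeo T where
  contDiff := hT.contDiff
  contDiff_symm := hT.contDiff_symm
  measurePreserving := by
    have hTm := hT.contDiff.continuous.measurable
    refine ⟨hTm, Measure.ext fun S hS => ?_⟩
    have h := lintegral_abs_det_fderiv_eq_addHaar_image volume (hTm hS)
      (fun x _ => (hT.contDiff.differentiable one_ne_zero x).hasFDerivAt.hasFDerivWithinAt)
      T.injective.injOn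
    rw [Measure.map_apply hTm hS]
    simpa [hT.det_fderiv, image_preimage_eq _ T.surjective] using h

lemma IsSymplecticMap.inv_jac {T : Plane ≃ Plane} (hT : IsSymplecticMap T) (x : Plane) :
    (jac T x)⁻¹ = !![jac T x 1 1, -jac T x 0 1; -jac T x 1 0, jac T x 0 0] := by
  rw [Matrix.inv_def, Matrix.det_fin_two, hT.det_jac, Ring.inverse_one, one_smul,
    Matrix.adjugate_fin_two]

/-- Since `det J = 1`, `J⁻ᵀ` is the cofactor matrix of `J`, and `J⁻ᵀ x = -rot (J (rot x))`;
rotations preserve length. -/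
lemma IsSymplecticMap.tangentialJacobian_eq {T : Plane ≃ Plane} (hT : IsSymplecticMap T)
    (x : Plane) : tangentialJacobian T x = ‖fderiv ℝ T x (rot x)‖ := by
  rw [tangentialJacobian, hT.inv_jac, EuclideanSpace.norm_eq, EuclideanSpace.norm_eq]
  congr 1
  simp only [Fin.sum_univ_two, fderiv_apply_eq, Real.norm_eq_abs, sq_abs]
  simp [Matrix.toLpLin_apply, rot]
  ring

lemma IsSymplecticMap.inner_metricTensor {T : Plane ≃ Plane} (hT : IsSymplecticMap T)
    (g h : Plane → Plane) (x : Plane) :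
    inner ℝ (Matrix.toEuclideanLin (metricTensor T x) (pullbackGrad T g x)) (pullbackGrad T h x)
      = inner ℝ (g (T x)) (h (T x)) := by
  have hd := hT.det_jac x
  rw [metricTensor, hT.inv_jac]
  simp only [PiLp.inner_apply, Fin.sum_univ_two, Matrix.toLpLin_apply, Matrix.mulVec,
    dotProduct, Matrix.mul_apply, pullbackGrad, adjoint_fderiv_apply_eq]
  simp
  generalize jac T x 0 0 = a at *
  generalize jac T x 0 1 = b at *
  generalize jac T x 1 0 = c at *
  generalize jac T x 1 1 = d at *
  -- With the inverse written as the adjugate, the left side is `(det J)²` times the inner product,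
  -- and `(det J)² - 1 = (det J + 1)(det J - 1)`.
  linear_combination (a * d - b * c + 1) * ((h (T x)) 0 * (g (T x)) 0 + (h (T x)) 1 * (g (T x)) 1) * hd

/-! ### The two forms -/

/-- The bilinear form `∫_Ω ∇u·∇φ + κ ∫_{∂Ω} u φ` of the Robin problem. -/
noncomputable def robinForm (Ω : Set Plane) (κ : ℝ) (u φ : Plane → ℝ) : ℝ :=
  (∫ x in Ω, inner ℝ (weakGrad Ω u x) (weakGrad Ω φ x))
    + κ * (∫ x, trace Ω u x * trace Ω φ x ∂(bdry Ω))

lemma integral_add_two_mul_add {α : Type*} [MeasurableSpace α] {μ : Measure α} {f g h : α → ℝ}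
    (hf : Integrable f μ) (hg : Integrable g μ) (hh : Integrable h μ) :
    ∫ x, (f x + 2 * g x + h x) ∂μ = (∫ x, f x ∂μ) + 2 * (∫ x, g x ∂μ) + ∫ x, h x ∂μ := by
  have hi : Integrable (fun x => f x + 2 * g x) μ := hf.add (hg.const_mul 2)
  rw [integral_add hi hh, integral_add hf (hg.const_mul 2), integral_const_mul]

lemma IsTraceDomain.robinForm_add_self {Ω : Set Plane} (hΩ : IsTraceDomain Ω) (κ : ℝ)
    {u v : Plane → ℝ} (hu : MemH1 Ω u) (hv : MemH1 Ω v) :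
    robinForm Ω κ (fun x => u x + v x) (fun x => u x + v x)
      = robinForm Ω κ u u + 2 * robinForm Ω κ u v + robinForm Ω κ v v := by
  have mu := hu.memLp_weakGrad hΩ.isOpen
  have mv := hv.memLp_weakGrad hΩ.isOpen
  have tu := (hΩ.isTrace_trace hu).1
  have tv := (hΩ.isTrace_trace hv).1
  have e1 : ∫ x in Ω, inner ℝ (weakGrad Ω (fun x => u x + v x) x)
        (weakGrad Ω (fun x => u x + v x) x)
      = (∫ x in Ω, inner ℝ (weakGrad Ω u x) (weakGrad Ω u x))
        + 2 * (∫ x in Ω, inner ℝ (weakGrad Ω u x) (weakGrad Ω v x))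
        + ∫ x in Ω, inner ℝ (weakGrad Ω v x) (weakGrad Ω v x) := by
    rw [← integral_add_two_mul_add (integrable_inner_of_memLp_two mu mu)
      (integrable_inner_of_memLp_two mu mv) (integrable_inner_of_memLp_two mv mv)]
    refine integral_congr_ae ?_
    filter_upwards [hu.weakGrad_add hΩ.isOpen hv] with x hx
    rw [hx, real_inner_add_add_self]
  have e2 : ∫ x, trace Ω (fun x => u x + v x) x * trace Ω (fun x => u x + v x) x ∂(bdry Ω)
      = (∫ x, trace Ω u x * trace Ω u x ∂(bdry Ω))
        + 2 * (∫ x, trace Ω u x * trace Ω v x ∂(bdry Ω))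
        + ∫ x, trace Ω v x * trace Ω v x ∂(bdry Ω) := by
    refine Eq.trans ?_ (integral_add_two_mul_add (tu.integrable_mul tu) (tu.integrable_mul tv)
      (tv.integrable_mul tv))
    refine integral_congr_ae ?_
    filter_upwards [hΩ.trace_add hu hv] with x hx
    simp only [hx]
    ring
  rw [robinForm, robinForm, robinForm, robinForm, e1, e2]
  ring

lemma integral_inner_weakGrad_self_nonneg (Ω : Set Plane) (u : Plane → ℝ) :
    0 ≤ ∫ x in Ω, inner ℝ (weakGrad Ω u x) (weakGrad Ω u x) :=
  integral_nonneg fun _ => real_inner_self_nonneg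

lemma integral_trace_mul_self_nonneg (Ω : Set Plane) (u : Plane → ℝ) :
    0 ≤ ∫ x, trace Ω u x * trace Ω u x ∂(bdry Ω) :=
  integral_nonneg fun _ => mul_self_nonneg _

lemma robinForm_self_nonneg (Ω : Set Plane) {κ : ℝ} (hκ : 0 ≤ κ) (u : Plane → ℝ) :
    0 ≤ robinForm Ω κ u u :=
  add_nonneg (integral_inner_weakGrad_self_nonneg Ω u)
    (mul_nonneg hκ (integral_trace_mul_self_nonneg Ω u))

lemma IsTraceDomain.ae_eq_zero_of_robinForm_self_nonpos {Ω : Set Plane} (hΩ : IsTraceDomain Ω)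
    {κ : ℝ} (hκ : 0 < κ) {u : Plane → ℝ} (hu : MemH1 Ω u) (h : robinForm Ω κ u u ≤ 0) :
    weakGrad Ω u =ᵐ[volume.restrict Ω] 0 ∧ trace Ω u =ᵐ[bdry Ω] 0 := by
  have h1 := integral_inner_weakGrad_self_nonneg Ω u
  have h2 := integral_trace_mul_self_nonneg Ω u
  rw [robinForm] at h
  have z1 : ∫ x in Ω, inner ℝ (weakGrad Ω u x) (weakGrad Ω u x) = 0 := by
    nlinarith [mul_nonneg hκ.le h2]
  have z2 : ∫ x, trace Ω u x * trace Ω u x ∂(bdry Ω) = 0 := by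
    nlinarith [mul_nonneg hκ.le h2]
  have mu := hu.memLp_weakGrad hΩ.isOpen
  have tu := (hΩ.isTrace_trace hu).1
  constructor
  · have := (integral_eq_zero_iff_of_nonneg (fun _ => real_inner_self_nonneg)
      (integrable_inner_of_memLp_two mu mu)).1 z1
    filter_upwards [this] with x hx
    exact inner_self_eq_zero.1 hx
  · have := (integral_eq_zero_iff_of_nonneg (fun _ => mul_self_nonneg _)
      (tu.integrable_mul tu)).1 z2
    filter_upwards [this] with x hx
    exact mul_self_eq_zero.1 hx

/-- The interior terms agree by the weak chain rule and the cancellation of `Jᵀ` against `A`; the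
boundary terms agree because the arc-length density is the tangential Jacobian. -/
lemma IsSymplecticMap.diskForm_comp {T : Plane ≃ Plane} (hT : IsSymplecticMap T) (κ : ℝ)
    {u v : Plane → ℝ} (hu : MemH1 (T '' disk) u) (hv : MemH1 (T '' disk) v) :
    diskForm T κ (u ∘ T) (v ∘ T) = robinForm (T '' disk) κ u v := by
  have hV := hT.isVolumeDiffeo
  have hmp := hV.restrict_preimage (T '' disk)
  rw [preimage_image_disk] at hmp
  have hm : Measurable fun x : Plane => ‖fderiv ℝ T x (rot x)‖ₑ :=
    hV.continuous_tangent.enorm.measurable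
  rw [diskForm, robinForm]
  refine congrArg₂ (· + κ * ·) ?_ ?_
  · rw [← hmp.integral_comp hV.measurableEmbedding]
    refine integral_congr_ae ?_
    filter_upwards [hV.weakGrad_comp_disk hu, hV.weakGrad_comp_disk hv] with x h1 h2
    rw [h1, h2, hT.inner_metricTensor]
  · rw [hV.bdry_image, hV.measurableEmbedding.integral_map,
      integral_withDensity_eq_integral_toReal_smul hm (Eventually.of_forall fun x => by simp)]
    refine integral_congr_ae ?_
    filter_upwards [hV.trace_comp_disk hu, hV.trace_comp_disk hv] with x h1 h2
    rw [h1, h2, hT.tangentialJacobian_eq]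
    simp

lemma diskEnergy_eq (T : Plane → Plane) (κ : ℝ) (G : (Plane → ℝ) → ℝ) (v : Plane → ℝ) :
    diskEnergy T κ G v = (1 / 2) * diskForm T κ v v - G v := by
  rw [diskEnergy, diskForm]
  simp only [sq]
  ring

/-! ### Transport of source terms. -/

lemma IsVolumeDiffeo.exists_h1Norm_comp_symm_le {T : Plane ≃ Plane} (hT : IsVolumeDiffeo T) :
    ∃ C : ℝ, 0 ≤ C ∧ ∀ v, MemH1 disk v → h1Norm (T '' disk) (v ∘ T.symm) ≤ C * h1Norm disk v := by
  have hb := hT.isTraceDomain_image.isBounded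
  obtain ⟨M, hM0, hM⟩ := hT.symm.exists_norm_fderiv_le hb
  -- The `L²` part is preserved and the gradient part grows at most by `M ^ 2`; `(1 + M) ^ 2`
  -- dominates both `1` and `M ^ 2`.
  refine ⟨1 + M, by positivity, fun v hv => ?_⟩
  have hmp := hT.symm.restrict_preimage disk
  have hw := hT.symm.weakGrad_comp Metric.isOpen_ball Metric.isBounded_ball hv
  rw [symm_preimage_disk] at hmp hw
  have mg := hv.memLp_weakGrad Metric.isOpen_ball
  have e1 : ∫ x in T '' disk, (v ∘ T.symm) x ^ 2 = ∫ x in disk, v x ^ 2 :=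
    hmp.integral_comp hT.symm.measurableEmbedding (fun x => v x ^ 2)
  have e2 : ∫ x in T '' disk, ‖weakGrad (T '' disk) (v ∘ T.symm) x‖ ^ 2
      ≤ M ^ 2 * ∫ x in disk, ‖weakGrad disk v x‖ ^ 2 := by
    rw [← hmp.integral_comp hT.symm.measurableEmbedding (fun x => ‖weakGrad disk v x‖ ^ 2),
      ← integral_const_mul]
    refine integral_mono_ae ((hT.memH1_comp_symm hv).memLp_weakGrad
      hT.isTraceDomain_image.isOpen |>.integrable_norm_pow two_ne_zero)
      (((mg.comp_measurePreserving hmp).integrable_norm_pow two_ne_zero).const_mul _) ?_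
    filter_upwards [hw, ae_restrict_mem hT.isTraceDomain_image.isOpen.measurableSet] with x h1 hx
    rw [h1, ← mul_pow]
    gcongr
    exact norm_pullbackGrad_le (hM x hx)
  have n1 : 0 ≤ ∫ x in disk, v x ^ 2 := integral_nonneg fun _ => sq_nonneg _
  have n2 : 0 ≤ ∫ x in disk, ‖weakGrad disk v x‖ ^ 2 := integral_nonneg fun _ => sq_nonneg _
  rw [h1Norm, h1Norm, e1]
  refine Real.sqrt_le_iff.2 ⟨by positivity, ?_⟩
  rw [mul_pow, Real.sq_sqrt (add_nonneg n1 n2)]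
  nlinarith [mul_nonneg hM0 n1, mul_nonneg hM0 n2, mul_nonneg (mul_nonneg hM0 hM0) n1]

lemma IsVolumeDiffeo.isH1Dual_sourceComp {T : Plane ≃ Plane} (hT : IsVolumeDiffeo T)
    {F : (Plane → ℝ) → ℝ} (hF : IsH1Dual (T '' disk) F) : IsH1Dual disk (sourceComp F T) where
  map_add _ _ hu hv := hF.map_add _ _ (hT.memH1_comp_symm hu) (hT.memH1_comp_symm hv)
  map_smul c _ hu := hF.map_smul c _ (hT.memH1_comp_symm hu)
  bound := by
    obtain ⟨C, hC⟩ := hF.bound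
    obtain ⟨K, hK, hKle⟩ := hT.exists_h1Norm_comp_symm_le
    -- The bound `C` of a functional carries no sign, so its absolute value is needed before
    -- enlarging the norm.
    refine ⟨|C| * K, fun v hv => (hC _ (hT.memH1_comp_symm hv)).trans ?_⟩
    have h0 : 0 ≤ h1Norm (T '' disk) (v ∘ T.symm) := Real.sqrt_nonneg _
    calc C * h1Norm (T '' disk) (v ∘ T.symm) ≤ |C| * h1Norm (T '' disk) (v ∘ T.symm) := by
          gcongr
          exact le_abs_self C
      _ ≤ |C| * (K * h1Norm disk v) := by
          gcongr
          exact hKle v hv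
      _ = _ := by ring

lemma IsVolumeDiffeo.isGivenBy_sourceComp {T : Plane ≃ Plane} (hT : IsVolumeDiffeo T)
    {F : (Plane → ℝ) → ℝ} {f : Plane → ℝ} (hf : IsGivenBy (T '' disk) F f) :
    IsGivenBy disk (sourceComp F T) (f ∘ T) := by
  intro v hv
  have hmp := hT.restrict_preimage (T '' disk)
  rw [preimage_image_disk] at hmp
  obtain ⟨h1, h2⟩ := hf _ (hT.memH1_comp_symm hv)
  have e : (fun x => (f ∘ T) x * v x) = (fun y => f y * (v ∘ T.symm) y) ∘ T := by
    funext x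
    simp
  rw [e]
  refine ⟨(hmp.integrable_comp_emb hT.measurableEmbedding).2 h1, h2.trans ?_⟩
  exact (hmp.integral_comp hT.measurableEmbedding _).symm

end Forms

end RobinSymp

/-! ### Minimality and uniqueness of the transported solution. -/

open RobinSymp

theorem mainTheorem3 (T : Plane ≃ Plane) (hT : IsSymplecticMap T) (κ : ℝ) (hκ : 0 ≤ κ)
    (F : (Plane → ℝ) → ℝ) (hF : IsH1Dual (T '' disk) F)
    (u : Plane → ℝ) (hu : IsRobinPoissonSolution (T '' disk) κ F u) :
    -- the transformed source `f ∘ T`, which is the composed function when `f` is a function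
    IsH1Dual disk (sourceComp F T) ∧
    (∀ f : Plane → ℝ, IsGivenBy (T '' disk) F f → IsGivenBy disk (sourceComp F T) (f ∘ T)) ∧
    -- `w = u ∘ T` is in `H¹`, attains the infimum and satisfies the variational equation
    MemH1 disk (u ∘ T) ∧
    IsDiskMinimizer T κ (sourceComp F T) (u ∘ T) ∧
    (∀ φ, MemH1 disk φ → diskForm T κ (u ∘ T) φ = sourceComp F T φ) ∧
    -- uniqueness
    (0 < κ → ∀ v, IsDiskMinimizer T κ (sourceComp F T) v →
      v =ᵐ[volume.restrict disk] u ∘ T) := by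
  have hV := hT.isVolumeDiffeo
  have hΩ := hV.isTraceDomain_image
  obtain ⟨hu1, hu2⟩ := hu
  have hw := hV.memH1_comp_disk hu1
  have comp_symm : ∀ φ : Plane → ℝ, (φ ∘ T.symm) ∘ T = φ := fun φ => by
    funext x
    simp
  have comp_self : (u ∘ T) ∘ T.symm = u := by
    funext x
    simp
  -- Exact second-order expansion of the energy at `u ∘ T`, with `z = v ∘ T⁻¹ - u`. The first-order
  -- term `robinForm u z - F z` vanishes by the weak equation. Existence of a minimizer and
  -- uniqueness both follow from this identity.
  have energy : ∀ v, MemH1 disk v → ∃ z, MemH1 (T '' disk) z ∧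
      (∀ x, z (T x) = v x - u (T x)) ∧
      diskEnergy T κ (sourceComp F T) v = diskEnergy T κ (sourceComp F T) (u ∘ T)
        + (1 / 2) * robinForm (T '' disk) κ z z := by
    intro v hv
    have hv' := hV.memH1_comp_symm hv
    have hz := hv'.add (hu1.const_mul (-1))
    refine ⟨_, hz, fun x => by simp; ring, ?_⟩
    set z : Plane → ℝ := fun x => (v ∘ T.symm) x + -1 * u x
    have hsplit : v ∘ T.symm = fun x => u x + z x := by
      funext x
      simp [z]
    have q := hΩ.robinForm_add_self κ hu1 hz
    have a := hF.map_add _ _ hu1 hz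
    rw [← hsplit] at q a
    have b : robinForm (T '' disk) κ u z = F z := hu2 z hz
    have d1 := hT.diskForm_comp κ hv' hv'
    have d2 := hT.diskForm_comp κ hu1 hu1
    rw [comp_symm] at d1
    rw [diskEnergy_eq, diskEnergy_eq, d1, d2, sourceComp, sourceComp, comp_self, q, a, b]
    ring
  refine ⟨hV.isH1Dual_sourceComp hF, fun f hf => hV.isGivenBy_sourceComp hf, hw, ⟨hw, ?_⟩, ?_, ?_⟩
  · intro v hv
    obtain ⟨z, -, -, he⟩ := energy v hv
    have := robinForm_self_nonneg (T '' disk) hκ z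
    linarith
  · intro φ hφ
    have h := hT.diskForm_comp κ hu1 (hV.memH1_comp_symm hφ)
    rw [comp_symm] at h
    exact h.trans (hu2 _ (hV.memH1_comp_symm hφ))
  · intro hκ' v hv
    obtain ⟨z, hz, hzT, he⟩ := energy v hv.1
    have hle := hv.2 _ hw
    -- Minimality of `v` compared with `u ∘ T` in the expansion `he` forces `robinForm z z ≤ 0`.
    obtain ⟨g0, t0⟩ := hΩ.ae_eq_zero_of_robinForm_self_nonpos hκ' hz (by linarith)
    have hmp := hV.restrict_preimage (T '' disk)
    rw [preimage_image_disk] at hmp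
    have gz : weakGrad disk (z ∘ T) =ᵐ[volume.restrict disk] 0 := by
      filter_upwards [hV.weakGrad_comp_disk hz, hmp.quasiMeasurePreserving.ae g0] with x h1 h2
      rw [h1, pullbackGrad, h2]
      simp
    -- Null sets of `∂Ω` must pull back to null sets of the circle, which is the lower bound on the
    -- arc-length density.
    have tz : trace disk (z ∘ T) =ᵐ[bdry disk] 0 := by
      obtain ⟨C, hC, hCle⟩ := hV.map_bdry_disk_le
      have t1 : ∀ᵐ x ∂((bdry disk).map T), trace (T '' disk) z x = (0 : Plane → ℝ) x :=
        (Measure.absolutelyContinuous_of_le_smul hCle).ae_le t0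
      rw [hV.measurableEmbedding.ae_map_iff] at t1
      filter_upwards [hV.trace_comp_disk hz, t1] with x h1 h2
      rw [h1]
      exact h2
    filter_upwards [ae_eq_zero_of_weakGrad_of_trace (hV.memH1_comp_disk hz) gz tz] with x hx
    have := hzT x
    simp only [Function.comp_apply, Pi.zero_apply] at hx ⊢
    linarith
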